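/- Let $\Gamma$ be a locally compact (Hausdorff, not necessarily second countable) amenable group with left Haar measure $|\cdot|$, and let $(X,\mu)$ be a probability space. A net $(\Phi_\alpha)_{\alpha\in A}$ of compact subsets of $\Gamma$ of positive measure is called a Følner net if $\lim_\alpha \sup_{l\in K}|l\Phi_\alpha\,\Delta\,\Phi_\alpha|/|\Phi_\alpha|=0$ for every compact set $K\subset\Gamma$. Let $j\ge 0$ and let $\tau_1,\dots,\tau_j$ be measure-preserving actions of $\Gamma$ on $X$ (identities between transformations being understood $\mu$-almost everywhere) which are measurable in the sense that for every $f\in L^2(X)$ and every $i$ the map $m\mapsto f\circ\tau_i(m)$ from $\Gamma$ to $L^2(X)$ is strongly measurable, up to Haar null sets, on every compact subset of $\Gamma$. Suppose that the actions commute pairwise, in the sense that $$\tau_i(m)\tau_k(n)=\tau_k(n)\tau_i(m)\quad\text{whenever } m,n\in\Gamma,\ i\ne k,$$ and let $f_0,\dots,f_j\in L^\infty(X)$ (real- or complex-valued) be arbitrary. Then the map sending $m\in\Gamma$ to the function $x\mapsto f_0(x)\,f_1(\tau_1(m)x)\,f_2(\tau_1(m)\tau_2(m)x)\cdots f_j(\tau_1(m)\cdots\tau_j(m)x)$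 in $L^2(X)$ is Bochner integrable over every compact subset of $\Gamma$, and for every Følner net $(\Phi_\alpha)_{\alpha\in A}$ in $\Gamma$ the limit $$\lim_{\alpha\in A}\ \frac{1}{|\Phi_\alpha|}\int_{\Phi_\alpha} f_0(x)\,f_1(\tau_1(m)x)\cdots f_j(\tau_1(m)\cdots\tau_j(m)x)\,dm$$ exists in $L^2(X)$ and is independent of the Følner net $(\Phi_\alpha)_{\alpha\in A}$. -/

import Mathlib

open MeasureTheory Filter Topology
open scoped ENNReal Pointwise symmDiff

/-- A Følner net in a locally compact group `Γ` with left Haar measure `haar`: a net of compact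
sets of positive measure (so that the quotients below make sense; in particular they are nonempty)
such that `sup_{l ∈ K} |l Φ_α ∆ Φ_α| / |Φ_α| → 0` for every compact set `K`. -/
structure IsFolnerNet {Γ : Type*} [Group Γ] [TopologicalSpace Γ] [MeasurableSpace Γ]
    (haar : Measure Γ) {A : Type*} [Preorder A] (Φ : A → Set Γ) : Prop where
  isCompact : ∀ α, IsCompact (Φ α)
  measure_pos : ∀ α, 0 < haar (Φ α)
  tendsto_zero : ∀ K : Set Γ, IsCompact K →
    Tendsto (fun α => ⨆ l ∈ K, haar ((l • Φ α) ∆ Φ α) / haar (Φ α)) atTop (𝓝 0)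

/-- A (left) action of the group `Γ` by measure-preserving transformations of the measure space
`(X, μ)`. As usual in measure theory, maps are identified when they agree almost everywhere, so
that the action laws are only required up to null sets. -/
structure MeasurePreservingAction (Γ : Type*) [Group Γ] {X : Type*} [MeasurableSpace X]
    (μ : Measure X) where
  toFun : Γ → X → X
  measurePreserving : ∀ m, MeasurePreserving (toFun m) μ μ
  map_one : toFun 1 =ᵐ[μ] id
  map_mul : ∀ m n, toFun (m * n) =ᵐ[μ] toFun m ∘ toFun n

namespace MeasurePreservingAction

variable {Γ : Type*} [Group Γ] {X : Type*} [MeasurableSpace X] {μ : Measure X}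

/-- The action is measurable: for each `f ∈ L²(X)`, the map `m ↦ f ∘ τ(m)` from `Γ` to `L²(X)` is
strongly measurable on every compact set, up to a Haar null set. -/
def IsMeasurable [TopologicalSpace Γ] [MeasurableSpace Γ] (haar : Measure Γ)
    (τ : MeasurePreservingAction Γ μ) : Prop :=
  ∀ f : Lp ℝ 2 μ, ∀ K : Set Γ, IsCompact K →
    AEStronglyMeasurable
      (fun m => Lp.compMeasurePreserving (τ.toFun m) (τ.measurePreserving m) f) (haar.restrict K)

/-- Two actions commute if `τ(m) σ(n) = σ(n) τ(m)` almost everywhere, for all `m, n ∈ Γ`. -/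
def Commutes (τ σ : MeasurePreservingAction Γ μ) : Prop :=
  ∀ m n, τ.toFun m ∘ σ.toFun n =ᵐ[μ] σ.toFun n ∘ τ.toFun m

variable {j : ℕ}

/-- The transformation `τ₁(m) ∘ ⋯ ∘ τₖ(m)` for `0 ≤ k ≤ j` (the identity for `k = 0`). The actions
`τ₁, …, τⱼ` are indexed by `Fin j`, i.e. `τᵢ` is `τ (i - 1)`. -/
def partialComp (τ : Fin j → MeasurePreservingAction Γ μ) (m : Γ) (k : Fin (j + 1)) : X → X :=
  Fin.induction (motive := fun _ => X → X) id (fun i T => T ∘ (τ i).toFun m) k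

theorem measurePreserving_partialComp (τ : Fin j → MeasurePreservingAction Γ μ) (m : Γ)
    (k : Fin (j + 1)) : MeasurePreserving (partialComp τ m k) μ μ := by
  induction k using Fin.induction with
  | zero => exact MeasurePreserving.id μ
  | succ i ih => exact ih.comp ((τ i).measurePreserving m)

theorem memLp_multicorrelation {𝕜 : Type*} [RCLike 𝕜] [IsFiniteMeasure μ]
    (τ : Fin j → MeasurePreservingAction Γ μ) (f : Fin (j + 1) → Lp 𝕜 ∞ μ) (m : Γ) :
    MemLp (fun x => ∏ k, f k (partialComp τ m k x)) 2 μ := by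
  have h : MemLp (fun x => ∏ k, f k (partialComp τ m k x)) ∞ μ := by
    have := MemLp.prod' (s := Finset.univ) (μ := μ) (p := fun _ : Fin (j + 1) => (∞ : ℝ≥0∞))
      (f := fun k x => f k (partialComp τ m k x))
      (fun k _ => (Lp.memLp (f k)).comp_measurePreserving (measurePreserving_partialComp τ m k))
    simpa using this
  exact h.mono_exponent le_top

/-- The function `x ↦ f₀(x) f₁(τ₁(m)x) ⋯ fⱼ(τ₁(m)⋯τⱼ(m)x)` as an element of `L²(X)`, for
`f₀, …, fⱼ ∈ L^∞(X)`. -/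
noncomputable def multicorrelation {𝕜 : Type*} [RCLike 𝕜] [IsFiniteMeasure μ]
    (τ : Fin j → MeasurePreservingAction Γ μ) (f : Fin (j + 1) → Lp 𝕜 ∞ μ) (m : Γ) : Lp 𝕜 2 μ :=
  (memLp_multicorrelation τ f m).toLp (fun x => ∏ k, f k (partialComp τ m k x))

end MeasurePreservingAction

/-! Every Følner net factors through one filter on compact sets, `folnerFilter`, so a limit along
this filter serves all nets. A Steinhaus argument turns measurability into strong continuity, and
splitting into real and imaginary parts leaves a real algebra `𝓐` of bounded functions with Koopman
operators S_k(m), the product of the first k actions at m.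

The proof is an induction on the number of factors for a stronger statement: the factors are bounded
families in `𝓐` over an index space I, and convergence holds in the Hilbert space that an arbitrary
positive mean on I induces on families. This strength is needed because the inductive step enlarges
I.

Fix the factors f_k with k < n and let A_Φ be the average as an operator in the last factor. The w
for which A_Φ w converges form a closed subspace G, so it suffices that w ⊥ G forces A_Φ w → 0
(`tendsto_averageCLM_zero`). Otherwise ‖A_Φ w‖ ≥ ε along an ultrafilter U. Up to replacing w by a
nearby bounded family, ‖A_Φ w‖² is the average over m ∈ Φ of ⟨w, s(Φ, m)⟩, where s(Φ, m) =
S_n(m⁻¹)(∏_{k<n} S_k(m) f_k · A_Φ w). On triples (Φ, m, i) take the mean that averages over m ∈ Φ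
and then passes to the limit along U. Then w correlates with s, hence with the image of s under the
adjoint of `inclusion`, a conditional expectation.

Commutativity gives S_n(l) S_n((lm)⁻¹) S_k(lm) = S_k(l) S_n(m⁻¹) S_k(m) for k ≤ n
(`partialAct_translate`). The shift of m to lm is invisible to the mean by the Følner property, so
A_Ψ of the conditional expectation of s is the conditional expectation of an average with only n
factors (`averageCLM_adjoint_dualFunction`). This converges by induction. Thus the conditional
expectation of s lies in G, contradicting w ⊥ G. -/

open scoped BoundedContinuousFunction

set_option linter.unusedSectionVars false

/-! ### The Følner filter -/

section FolnerFilter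

variable {Γ : Type*} [TopologicalSpace Γ] [MeasurableSpace Γ]

/-- The compact sets of positive measure. -/
def FolnerSet (haar : Measure Γ) := {Φ : Set Γ // IsCompact Φ ∧ 0 < haar Φ}

/-- The filter of asymptotically left invariant sets: a net of compact sets of positive measure
is a Følner net if and only if it tends to this filter. -/
noncomputable def folnerFilter [Group Γ] (haar : Measure Γ) : Filter (FolnerSet haar) :=
  ⨅ (K : Set Γ) (_ : IsCompact K),
    comap (fun Φ => ⨆ l ∈ K, haar ((l • Φ.1) ∆ Φ.1) / haar Φ.1) (𝓝 0)

theorem IsFolnerNet.tendsto_folnerFilter [Group Γ] {haar : Measure Γ} {A : Type*} [Preorder A]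
    {Φ : A → Set Γ} (h : IsFolnerNet haar Φ) :
    Tendsto (fun α => (⟨Φ α, h.isCompact α, h.measure_pos α⟩ : FolnerSet haar)) atTop
      (folnerFilter haar) := by
  exact tendsto_iInf.2 fun K => tendsto_iInf.2 fun hK => tendsto_comap_iff.2 (h.tendsto_zero K hK)

variable {haar : Measure Γ} [IsFiniteMeasureOnCompacts haar]

theorem FolnerSet.measure_lt_top (Φ : FolnerSet haar) : haar Φ.1 < ∞ := Φ.2.1.measure_lt_top

theorem FolnerSet.real_pos (Φ : FolnerSet haar) : 0 < haar.real Φ.1 :=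
  ENNReal.toReal_pos Φ.2.2.ne' Φ.measure_lt_top.ne

theorem eventually_folnerFilter [Group Γ] {K : Set Γ} (hK : IsCompact K) {δ : ℝ} (hδ : 0 < δ) :
    ∀ᶠ Φ in folnerFilter haar, ∀ l ∈ K,
      haar.real ((l • Φ.1) ∆ Φ.1) ≤ δ * haar.real Φ.1 := by
  have h : Tendsto (fun Φ : FolnerSet haar => ⨆ l ∈ K, haar ((l • Φ.1) ∆ Φ.1) / haar Φ.1)
      (folnerFilter haar) (𝓝 0) :=
    tendsto_comap.mono_left (iInf₂_le K hK)
  filter_upwards [h.eventually_le_const (ENNReal.ofReal_pos.2 hδ)] with Φ hΦ l hl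
  have h1 : haar ((l • Φ.1) ∆ Φ.1) / haar Φ.1 ≤ ENNReal.ofReal δ :=
    (le_iSup₂ (f := fun l _ => haar ((l • Φ.1) ∆ Φ.1) / haar Φ.1) l hl).trans hΦ
  rw [ENNReal.div_le_iff Φ.2.2.ne' Φ.measure_lt_top.ne] at h1
  have h2 := ENNReal.toReal_mono (ENNReal.mul_ne_top ENNReal.ofReal_ne_top
    Φ.measure_lt_top.ne) h1
  rwa [ENNReal.toReal_mul, ENNReal.toReal_ofReal hδ.le] at h2

end FolnerFilter

/-! ### Averages of continuous functions over compact sets -/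

section CompactIntegrals

variable {Γ : Type*} [TopologicalSpace Γ] [T2Space Γ] [LocallyCompactSpace Γ] [MeasurableSpace Γ]
  [BorelSpace Γ] {haar : Measure Γ} [IsFiniteMeasureOnCompacts haar]
  {E : Type*} [NormedAddCommGroup E] [NormedSpace ℝ E]

theorem FolnerSet.integrableOn (Φ : FolnerSet haar) {f : Γ → E} (hf : Continuous f) :
    IntegrableOn f Φ.1 haar :=
  hf.continuousOn.integrableOn_compact Φ.2.1

theorem setIntegral_congr_cutoff {Φ : Set Γ} (hΦ : IsCompact Φ) {χ : Γ → ℝ}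
    (hχ : Set.EqOn χ 1 Φ) (f : Γ → E) :
    ∫ m in Φ, f m ∂haar = ∫ m in Φ, χ m • f m ∂haar :=
  setIntegral_congr_fun hΦ.measurableSet fun m hm => by simp [hχ hm]

theorem exists_cutoff {Φ : Set Γ} (hΦ : IsCompact Φ) :
    ∃ χ : C(Γ, ℝ), Set.EqOn χ 1 Φ ∧ HasCompactSupport χ := by
  obtain ⟨χ, h1, -, h2, -⟩ := exists_continuous_one_zero_of_isCompact hΦ isClosed_empty
    (Set.disjoint_empty Φ)
  exact ⟨χ, h1, h2⟩

/-- Haar measure need not be σ-finite, so the usual Fubini theorem is not at hand. Cutoffs equal to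
1 on the two compact sets make the integrand continuous with compact support, where the order can be
exchanged. -/
theorem setIntegral_swap_of_continuous {Φ Ψ : Set Γ} (hΦ : IsCompact Φ) (hΨ : IsCompact Ψ)
    {q : Γ → Γ → E} (hq : Continuous q.uncurry) :
    ∫ l in Ψ, ∫ m in Φ, q l m ∂haar ∂haar = ∫ m in Φ, ∫ l in Ψ, q l m ∂haar ∂haar := by
  obtain ⟨χ, hχ, hχc⟩ := exists_cutoff hΦ
  obtain ⟨ψ, hψ, hψc⟩ := exists_cutoff hΨ
  have h1 : ∀ l, ∫ m in Φ, q l m ∂haar = ∫ m in Φ, χ m • q l m ∂haar := fun l =>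
    setIntegral_congr_cutoff hΦ hχ _
  have h2 : ∀ m, ∫ l in Ψ, q l m ∂haar = ∫ l in Ψ, ψ l • q l m ∂haar := fun m =>
    setIntegral_congr_cutoff hΨ hψ _
  rw [setIntegral_congr_cutoff hΨ hψ, setIntegral_congr_cutoff hΦ hχ]
  simp_rw [h1, h2, ← integral_smul]
  have h3 : ∀ m l, χ m • ψ l • q l m = ψ l • χ m • q l m := fun m l => smul_comm _ _ _
  simp_rw [h3]
  refine integral_integral_swap_of_hasCompactSupport ?_ ?_
  · have : Continuous fun p : Γ × Γ => ψ p.1 • χ p.2 • q.uncurry p := by fun_prop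
    exact this
  · refine HasCompactSupport.intro (hψc.isCompact.prod hχc.isCompact) fun p hp => ?_
    rw [Set.mem_prod, not_and_or] at hp
    rcases hp with h | h
    · simp [Function.uncurry, image_eq_zero_of_notMem_tsupport h]
    · simp [Function.uncurry, image_eq_zero_of_notMem_tsupport h]

/-- Again a cutoff replaces the compact domain by a compactly supported integrand, for which
continuous dependence on a parameter holds. -/
theorem continuous_setAverage {I : Type*} [TopologicalSpace I] {Φ : Set Γ} (hΦ : IsCompact Φ)
    {q : Γ → I → E} (hq : Continuous q.uncurry) :
    Continuous fun i => ⨍ m in Φ, q m i ∂haar := by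
  obtain ⟨χ, hχ, hχc⟩ := exists_cutoff hΦ
  have h1 : ∀ i, ∫ m in Φ, q m i ∂haar = ∫ m in Φ, χ m • q m i ∂haar := fun i =>
    setIntegral_congr_cutoff hΦ hχ _
  simp_rw [setAverage_eq, h1]
  refine Continuous.const_smul ?_ _
  rw [← continuousOn_univ]
  refine continuousOn_integral_of_compact_support hχc.isCompact (Continuous.continuousOn ?_) ?_
  · have : Continuous fun p : I × Γ => χ p.2 • q.uncurry (p.2, p.1) := by fun_prop
    exact this
  · intro i m _ hm
    simp [image_eq_zero_of_notMem_tsupport hm]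

theorem FolnerSet.setAverage_const (Φ : FolnerSet haar) (c : E) [CompleteSpace E] :
    ⨍ _ in Φ.1, c ∂haar = c :=
  MeasureTheory.setAverage_const Φ.2.2.ne' Φ.measure_lt_top.ne c

theorem FolnerSet.norm_setAverage_le (Φ : FolnerSet haar) {f : Γ → E} {C : ℝ}
    (h : ∀ m ∈ Φ.1, ‖f m‖ ≤ C) : ‖⨍ m in Φ.1, f m ∂haar‖ ≤ C := by
  rw [setAverage_eq, norm_smul, norm_inv, Real.norm_of_nonneg Φ.real_pos.le,
    inv_mul_le_iff₀ Φ.real_pos, mul_comm]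
  exact norm_setIntegral_le_of_norm_le_const Φ.measure_lt_top h

theorem FolnerSet.setAverage_add (Φ : FolnerSet haar) {f g : Γ → E} (hf : Continuous f)
    (hg : Continuous g) :
    ⨍ m in Φ.1, (f m + g m) ∂haar = (⨍ m in Φ.1, f m ∂haar) + ⨍ m in Φ.1, g m ∂haar := by
  simp only [setAverage_eq]
  rw [integral_add (Φ.integrableOn hf) (Φ.integrableOn hg), smul_add]

theorem FolnerSet.setAverage_sub (Φ : FolnerSet haar) {f g : Γ → E} (hf : Continuous f)
    (hg : Continuous g) :
    ⨍ m in Φ.1, (f m - g m) ∂haar = (⨍ m in Φ.1, f m ∂haar) - ⨍ m in Φ.1, g m ∂haar := by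
  simp only [setAverage_eq]
  rw [integral_sub (Φ.integrableOn hf) (Φ.integrableOn hg), smul_sub]

theorem FolnerSet.setAverage_smul (Φ : FolnerSet haar) (c : ℝ) (f : Γ → E) :
    ⨍ m in Φ.1, c • f m ∂haar = c • ⨍ m in Φ.1, f m ∂haar := by
  simp only [setAverage_eq]
  rw [integral_smul, smul_comm]

theorem FolnerSet.setAverage_nonneg (Φ : FolnerSet haar) {f : Γ → ℝ} (hf : ∀ m, 0 ≤ f m) :
    0 ≤ ⨍ m in Φ.1, f m ∂haar := by
  rw [setAverage_eq]
  exact smul_nonneg (inv_nonneg.2 Φ.real_pos.le) (integral_nonneg hf)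

theorem FolnerSet.setAverage_swap (Φ Ψ : FolnerSet haar) {q : Γ → Γ → E}
    (hq : Continuous q.uncurry) :
    ⨍ l in Ψ.1, ⨍ m in Φ.1, q l m ∂haar ∂haar = ⨍ m in Φ.1, ⨍ l in Ψ.1, q l m ∂haar ∂haar := by
  simp only [setAverage_eq, integral_smul]
  rw [setIntegral_swap_of_continuous Φ.2.1 Ψ.2.1 hq, smul_comm]

theorem FolnerSet.inner_setAverage {H : Type*} [NormedAddCommGroup H] [InnerProductSpace ℝ H]
    [CompleteSpace H] (Φ : FolnerSet haar) {f : Γ → H} (hf : Continuous f) (c : H) :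
    inner ℝ c (⨍ m in Φ.1, f m ∂haar) = ⨍ m in Φ.1, inner ℝ c (f m) ∂haar := by
  rw [setAverage_eq, setAverage_eq, inner_smul_right, integral_inner (Φ.integrableOn hf)]
  rfl

/-- By left invariance the translated integral is the integral over lΦ, so the two integrals differ
only on the symmetric difference of lΦ and Φ. This is the only place where almost invariance of Φ
enters an estimate. -/
theorem FolnerSet.abs_setAverage_translate_le [Group Γ] [IsTopologicalGroup Γ]
    [haar.IsMulLeftInvariant] (Φ : FolnerSet haar) {f : Γ → ℝ} (hf : Continuous f) {M δ : ℝ}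
    (hM : ∀ m, |f m| ≤ M) (l : Γ)
    (hl : haar.real ((l • Φ.1) ∆ Φ.1) ≤ δ * haar.real Φ.1) :
    |(⨍ m in Φ.1, f (l * m) ∂haar) - ⨍ m in Φ.1, f m ∂haar| ≤ M * δ := by
  have hM0 : 0 ≤ M := (abs_nonneg _).trans (hM 1)
  have hc : IsCompact (l • Φ.1) := Φ.2.1.smul l
  have h1 : ∫ m in Φ.1, f (l * m) ∂haar = ∫ m in l • Φ.1, f m ∂haar := by
    have := (measurePreserving_mul_left haar l).setIntegral_preimage_emb
      (MeasurableEquiv.mulLeft l).measurableEmbedding f (l • Φ.1)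
    rw [← this]
    congr 2
    ext m
    simp [Set.mem_smul_set_iff_inv_smul_mem]
  have hA := hc.measurableSet
  have hB := Φ.2.1.measurableSet
  have iA : IntegrableOn f (l • Φ.1) haar := hf.continuousOn.integrableOn_compact hc
  have iB : IntegrableOn f Φ.1 haar := Φ.integrableOn hf
  have h2 : (∫ m in l • Φ.1, f m ∂haar) - ∫ m in Φ.1, f m ∂haar
      = (∫ m in (l • Φ.1) \ Φ.1, f m ∂haar) - ∫ m in Φ.1 \ (l • Φ.1), f m ∂haar := by
    rw [← integral_inter_add_sdiff hB iA, ← integral_inter_add_sdiff hA iB, Set.inter_comm]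
    ring
  have fA : haar ((l • Φ.1) \ Φ.1) < ∞ :=
    (measure_mono Set.sdiff_subset).trans_lt hc.measure_lt_top
  have fB : haar (Φ.1 \ (l • Φ.1)) < ∞ :=
    (measure_mono Set.sdiff_subset).trans_lt Φ.measure_lt_top
  have h3 := norm_setIntegral_le_of_norm_le_const (f := f) fA fun m _ => hM m
  have h4 := norm_setIntegral_le_of_norm_le_const (f := f) fB fun m _ => hM m
  have h5 : haar.real ((l • Φ.1) ∆ Φ.1)
      = haar.real ((l • Φ.1) \ Φ.1) + haar.real (Φ.1 \ (l • Φ.1)) := by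
    rw [Set.symmDiff_def]
    exact measureReal_union disjoint_sdiff_sdiff (hB.diff hA) fA.ne fB.ne
  have h6 := abs_sub (∫ m in (l • Φ.1) \ Φ.1, f m ∂haar) (∫ m in Φ.1 \ (l • Φ.1), f m ∂haar)
  rw [setAverage_eq, setAverage_eq, ← smul_sub, h1, h2, smul_eq_mul, abs_mul, abs_inv,
    abs_of_pos Φ.real_pos, inv_mul_le_iff₀ Φ.real_pos]
  simp only [Real.norm_eq_abs] at h3 h4
  nlinarith [mul_le_mul_of_nonneg_left hl hM0]

end CompactIntegrals

/-! ### Abstract Koopman operators -/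

/-- An algebra `𝓐` of bounded functions, with its map `toL2` to an `L²` space `H` and a sequence of
commuting strongly continuous right actions of `Γ` on it. The predicate `Bdd C a` expresses that
`a` is bounded by `C`. -/
structure KoopmanModel (Γ 𝓐 H : Type*) [Group Γ] [TopologicalSpace Γ] [CommRing 𝓐] [Algebra ℝ 𝓐]
    [NormedAddCommGroup H] [InnerProductSpace ℝ H] where
  toL2 : 𝓐 →ₗ[ℝ] H
  toL2_injective : Function.Injective toL2
  Bdd : ℝ → 𝓐 → Prop
  bdd_nonneg : ∀ {C a}, Bdd C a → 0 ≤ C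
  bdd_algebraMap : ∀ r, Bdd |r| (algebraMap ℝ 𝓐 r)
  bdd_add : ∀ {C D a b}, Bdd C a → Bdd D b → Bdd (C + D) (a + b)
  bdd_mul : ∀ {C D a b}, Bdd C a → Bdd D b → Bdd (C * D) (a * b)
  norm_mul_le : ∀ {C a}, Bdd C a → ∀ b, ‖toL2 (a * b)‖ ≤ C * ‖toL2 b‖
  inner_mul : ∀ a b c, inner ℝ (toL2 (a * b)) (toL2 c) = inner ℝ (toL2 b) (toL2 (a * c))
  isClosed_bdd : ∀ C, IsClosed (toL2 '' {a | Bdd C a})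
  act : ℕ → Γ → 𝓐 →ₐ[ℝ] 𝓐
  bdd_act : ∀ i m {C a}, Bdd C a → Bdd C (act i m a)
  norm_act : ∀ i m a, ‖toL2 (act i m a)‖ = ‖toL2 a‖
  act_one : ∀ i, act i 1 = 1
  act_mul : ∀ i m n, act i (m * n) = act i n * act i m
  commute_act : ∀ i k, i ≠ k → ∀ m n, Commute (act i m) (act k n)
  continuous_act : ∀ i a, Continuous fun m => toL2 (act i m a)

namespace KoopmanModel

variable {Γ 𝓐 H : Type*} [Group Γ] [TopologicalSpace Γ] [CommRing 𝓐] [Algebra ℝ 𝓐]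
  [NormedAddCommGroup H] [InnerProductSpace ℝ H] (M : KoopmanModel Γ 𝓐 H)

/-- The composition of the first `k` actions. -/
def partialAct : ℕ → Γ → 𝓐 →ₐ[ℝ] 𝓐
  | 0, _ => 1
  | k + 1, m => M.act k m * partialAct k m

theorem commute_act_partialAct {i k : ℕ} (h : k ≤ i) (m n : Γ) :
    Commute (M.act i m) (M.partialAct k n) := by
  induction k with
  | zero => exact Commute.one_right _
  | succ k ih => exact (M.commute_act i k (by omega) m n).mul_right (ih (by omega))

theorem partialAct_one (k : ℕ) : M.partialAct k 1 = 1 := by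
  induction k with
  | zero => rfl
  | succ k ih => simp [partialAct, ih, M.act_one]

theorem partialAct_mul (k : ℕ) (m n : Γ) :
    M.partialAct k (m * n) = M.partialAct k n * M.partialAct k m := by
  induction k with
  | zero => rfl
  | succ k ih =>
    simp only [partialAct, ih, M.act_mul]
    rw [mul_assoc, ← mul_assoc (M.act k m), (M.commute_act_partialAct le_rfl m n).eq]
    simp only [mul_assoc]

theorem partialAct_inv_mul (k : ℕ) (m : Γ) : M.partialAct k m⁻¹ * M.partialAct k m = 1 := by
  rw [← partialAct_mul, mul_inv_cancel, partialAct_one]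

theorem partialAct_mul_inv (k : ℕ) (m : Γ) : M.partialAct k m * M.partialAct k m⁻¹ = 1 := by
  rw [← partialAct_mul, inv_mul_cancel, partialAct_one]

/-- For k ≤ n the operator S_n(m⁻¹) S_k(m) cancels the first k actions and leaves only those with
index from k to n - 1. These commute with S_k(l), which involves smaller indices only. -/
theorem commute_partialAct_inv_mul {k n : ℕ} (h : k ≤ n) (m l : Γ) :
    Commute (M.partialAct n m⁻¹ * M.partialAct k m) (M.partialAct k l) := by
  induction n, h using Nat.le_induction with
  | base => rw [partialAct_inv_mul]; exact Commute.one_left _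
  | succ n hn ih =>
    rw [partialAct, mul_assoc]
    exact (M.commute_act_partialAct hn _ _).mul_left ih

/-- This is the algebraic heart of the induction: the last operator S_n(l) is traded for S_k(l) with
k ≤ n. Both S_n and S_k reverse products, so S_n(l) cancels S_n(l⁻¹), and S_k(l) then moves to the
left by the preceding commutation. -/
theorem partialAct_translate {k n : ℕ} (h : k ≤ n) (l m : Γ) :
    M.partialAct n l * (M.partialAct n (l * m)⁻¹ * M.partialAct k (l * m)) =
      M.partialAct k l * (M.partialAct n m⁻¹ * M.partialAct k m) := by
  rw [mul_inv_rev, partialAct_mul, partialAct_mul, ← (M.commute_partialAct_inv_mul h m l).eq,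
    mul_assoc, mul_assoc, ← mul_assoc (M.partialAct n l), partialAct_mul_inv, one_mul]

theorem bdd_partialAct (k : ℕ) (m : Γ) {C : ℝ} {a : 𝓐} (h : M.Bdd C a) :
    M.Bdd C (M.partialAct k m a) := by
  induction k with
  | zero => exact h
  | succ k ih => exact M.bdd_act k m ih

theorem norm_partialAct (k : ℕ) (m : Γ) (a : 𝓐) :
    ‖M.toL2 (M.partialAct k m a)‖ = ‖M.toL2 a‖ := by
  induction k with
  | zero => rfl
  | succ k ih => exact (M.norm_act k m _).trans ih

theorem inner_partialAct (k : ℕ) (m : Γ) (a b : 𝓐) :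
    inner ℝ (M.toL2 (M.partialAct k m a)) (M.toL2 (M.partialAct k m b)) =
      inner ℝ (M.toL2 a) (M.toL2 b) := by
  simp only [real_inner_eq_norm_add_mul_self_sub_norm_mul_self_sub_norm_mul_self_div_two,
    ← map_add, norm_partialAct]

theorem inner_partialAct_inv (k : ℕ) (m : Γ) (a b : 𝓐) :
    inner ℝ (M.toL2 a) (M.toL2 (M.partialAct k m⁻¹ b)) =
      inner ℝ (M.toL2 (M.partialAct k m a)) (M.toL2 b) := by
  rw [← M.inner_partialAct k m]
  congr 2
  exact DFunLike.congr_fun (M.partialAct_mul_inv k m) b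

/-- The operators are isometric for the L² norm, so the change of the argument is controlled
uniformly in the group element; strong continuity handles the other variable. -/
theorem continuous_act_comp (i : ℕ) {J : Type*} [TopologicalSpace J] {s : J → Γ} {F : J → 𝓐}
    (hs : Continuous s) (hF : Continuous fun j => M.toL2 (F j)) :
    Continuous fun j => M.toL2 (M.act i (s j) (F j)) := by
  rw [continuous_iff_continuousAt]
  intro j₀
  have h1 : Tendsto (fun j => M.toL2 (M.act i (s j) (F j)) - M.toL2 (M.act i (s j) (F j₀)))
      (𝓝 j₀) (𝓝 0) := by
    rw [tendsto_zero_iff_norm_tendsto_zero]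
    simp only [← map_sub, norm_act]
    simp only [map_sub]
    rw [← tendsto_zero_iff_norm_tendsto_zero, tendsto_sub_nhds_zero_iff]
    exact hF.tendsto j₀
  have h2 := ((M.continuous_act i (F j₀)).comp hs).tendsto j₀
  simpa [ContinuousAt] using h1.add h2

theorem continuous_partialAct_comp (k : ℕ) {J : Type*} [TopologicalSpace J] {s : J → Γ}
    {F : J → 𝓐} (hs : Continuous s) (hF : Continuous fun j => M.toL2 (F j)) :
    Continuous fun j => M.toL2 (M.partialAct k (s j) (F j)) := by
  induction k with
  | zero => exact hF
  | succ k ih => exact M.continuous_act_comp k hs ih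

theorem bdd_smul (r : ℝ) {C : ℝ} {a : 𝓐} (h : M.Bdd C a) : M.Bdd (|r| * C) (r • a) := by
  rw [Algebra.smul_def]
  exact M.bdd_mul (M.bdd_algebraMap r) h

theorem convex_bdd (C : ℝ) : Convex ℝ (M.toL2 '' {a | M.Bdd C a}) := by
  refine Convex.linear_image (fun a ha b hb r s hr hs hrs => ?_) M.toL2
  have h := M.bdd_add (M.bdd_smul r ha) (M.bdd_smul s hb)
  rwa [abs_of_nonneg hr, abs_of_nonneg hs, ← add_mul, hrs, one_mul] at h

/-! ### Bounded families and their averages -/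

/-- The bounded families of elements of `𝓐` that are continuous in `L²`. -/
def families (J : Type*) [TopologicalSpace J] : Subalgebra ℝ (J → 𝓐) where
  carrier := {F | (∃ C, 0 ≤ C ∧ ∀ j, M.Bdd C (F j)) ∧ Continuous fun j => M.toL2 (F j)}
  algebraMap_mem' r := ⟨⟨|r|, abs_nonneg r, fun _ => M.bdd_algebraMap r⟩,
    (continuous_const : Continuous fun _ : J => M.toL2 (algebraMap ℝ 𝓐 r))⟩
  add_mem' := by
    rintro F G ⟨⟨C, hC0, hC⟩, hF⟩ ⟨⟨D, hD0, hD⟩, hG⟩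
    refine ⟨⟨C + D, add_nonneg hC0 hD0, fun j => M.bdd_add (hC j) (hD j)⟩, ?_⟩
    simp only [Pi.add_apply, map_add]
    exact hF.add hG
  mul_mem' := by
    rintro F G ⟨⟨C, hC0, hC⟩, hF⟩ ⟨⟨D, hD0, hD⟩, hG⟩
    refine ⟨⟨C * D, mul_nonneg hC0 hD0, fun j => M.bdd_mul (hC j) (hD j)⟩, ?_⟩
    rw [continuous_iff_continuousAt]
    intro j₀
    rw [ContinuousAt, tendsto_iff_norm_sub_tendsto_zero]
    have hF' := tendsto_iff_norm_sub_tendsto_zero.1 (hF.tendsto j₀)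
    have hG' := tendsto_iff_norm_sub_tendsto_zero.1 (hG.tendsto j₀)
    have h := (hG'.const_mul C).add (hF'.const_mul D)
    simp only [mul_zero, add_zero] at h
    -- Write FG - F₀G₀ = F(G - G₀) + G₀(F - F₀). The uniform bounds on F and G₀ make multiplication
    -- by them bounded in L².
    refine squeeze_zero (fun _ => norm_nonneg _) (fun j => ?_) h
    have h1 := M.norm_mul_le (hC j) (G j - G j₀)
    have h2 := M.norm_mul_le (hD j₀) (F j - F j₀)
    rw [map_sub] at h1 h2
    refine le_trans ?_ (add_le_add h1 h2)
    refine le_trans (le_of_eq ?_) (norm_add_le _ _)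
    rw [← map_add, ← map_sub]
    congr 2
    simp only [Pi.mul_apply]
    ring

variable {M} {I J : Type*} [TopologicalSpace I] [TopologicalSpace J]

theorem families.exists_bdd (F : M.families J) : ∃ C, 0 ≤ C ∧ ∀ j, M.Bdd C (F.1 j) := F.2.1

theorem families.continuous (F : M.families J) : Continuous fun j => M.toL2 (F.1 j) := F.2.2

/-- Pullback of a family. -/
def families.pull (p : C(J, I)) : M.families I →ₐ[ℝ] M.families J where
  toFun F := ⟨fun j => F.1 (p j),
    ⟨(families.exists_bdd F).imp fun _ h => ⟨h.1, fun j => h.2 (p j)⟩, (families.continuous F).comp p.continuous⟩⟩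
  map_one' := rfl
  map_mul' _ _ := rfl
  map_zero' := rfl
  map_add' _ _ := rfl
  commutes' _ := rfl

/-- The family `j ↦ S_k(s(j)) F(j)`. -/
def families.twist (k : ℕ) (s : C(J, Γ)) : M.families J →ₐ[ℝ] M.families J where
  toFun F := ⟨fun j => M.partialAct k (s j) (F.1 j),
    ⟨(families.exists_bdd F).imp fun _ h => ⟨h.1, fun j => M.bdd_partialAct k _ (h.2 j)⟩,
      M.continuous_partialAct_comp k s.continuous (families.continuous F)⟩⟩
  map_one' := Subtype.ext (funext fun _ => map_one _)
  map_mul' _ _ := Subtype.ext (funext fun _ => map_mul _ _ _)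
  map_zero' := Subtype.ext (funext fun _ => map_zero _)
  map_add' _ _ := Subtype.ext (funext fun _ => map_add _ _ _)
  commutes' r := Subtype.ext (funext fun _ => AlgHom.commutes _ r)

@[simp] theorem families.pull_apply (p : C(J, I)) (F : M.families I) (j : J) :
    (families.pull p F).1 j = F.1 (p j) := rfl

@[simp] theorem families.twist_apply (k : ℕ) (s : C(J, Γ)) (F : M.families J) (j : J) :
    (families.twist k s F).1 j = M.partialAct k (s j) (F.1 j) := rfl

theorem families.prod_apply {ι : Type*} (s : Finset ι) (F : ι → M.families J) (j : J) :
    (∏ k ∈ s, F k).1 j = ∏ k ∈ s, (F k).1 j := by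
  rw [← Finset.prod_apply]
  exact congrFun (map_prod (families M J).val F s) j

section Average

variable [CompleteSpace H] [T2Space Γ] [LocallyCompactSpace Γ] [MeasurableSpace Γ] [BorelSpace Γ]
  {haar : Measure Γ} [IsFiniteMeasureOnCompacts haar]

/-- An L² average of elements bounded by C stays in the image of `𝓐`, because the image of the
C-bounded elements is closed and convex. -/
theorem exists_average (M : KoopmanModel Γ 𝓐 H) (Φ : FolnerSet haar) {a : Γ → 𝓐}
    (hc : Continuous fun m => M.toL2 (a m)) (hb : ∃ C, ∀ m, M.Bdd C (a m)) :
    ∃ b, M.toL2 b = ⨍ m in Φ.1, M.toL2 (a m) ∂haar := by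
  obtain ⟨C, hC⟩ := hb
  obtain ⟨b, -, h⟩ := (M.convex_bdd C).set_average_mem (M.isClosed_bdd C) Φ.2.2.ne'
    Φ.measure_lt_top.ne (Eventually.of_forall fun m => ⟨a m, hC m, rfl⟩) (Φ.integrableOn hc)
  exact ⟨b, h⟩

/-- Injectivity of `toL2` identifies the arbitrary preimage b with the bounded one found by
convexity, so chosen averages inherit every bound. -/
theorem bdd_of_toL2_eq_average (Φ : FolnerSet haar) {a : Γ → 𝓐}
    (hc : Continuous fun m => M.toL2 (a m)) {C : ℝ} (hC : ∀ m, M.Bdd C (a m)) {b : 𝓐}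
    (hb : M.toL2 b = ⨍ m in Φ.1, M.toL2 (a m) ∂haar) : M.Bdd C b := by
  obtain ⟨b', hb', h⟩ := (M.convex_bdd C).set_average_mem (M.isClosed_bdd C) Φ.2.2.ne'
    Φ.measure_lt_top.ne (Eventually.of_forall fun m => ⟨a m, hC m, rfl⟩) (Φ.integrableOn hc)
  rwa [M.toL2_injective (hb.trans h.symm)]

theorem families.continuous_left (F : M.families (Γ × I)) (i : I) :
    Continuous fun m => M.toL2 (F.1 (m, i)) := (families.continuous F).comp (by fun_prop)

theorem families.exists_average (Φ : FolnerSet haar) (F : M.families (Γ × I)) (i : I) :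
    ∃ b, M.toL2 b = ⨍ m in Φ.1, M.toL2 (F.1 (m, i)) ∂haar :=
  M.exists_average Φ (families.continuous_left F i)
    ((families.exists_bdd F).imp fun _ h m => h.2 (m, i))

/-- The average of a family over a compact set of positive measure. -/
noncomputable def families.average (Φ : FolnerSet haar) : M.families (Γ × I) →ₗ[ℝ] M.families I :=
  { toFun := fun F => ⟨fun i => (families.exists_average Φ F i).choose, by
      constructor
      · exact (families.exists_bdd F).imp fun C h => ⟨h.1, fun i =>
          bdd_of_toL2_eq_average Φ (families.continuous_left F i) (fun m => h.2 (m, i))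
            (families.exists_average Φ F i).choose_spec⟩
      · simp_rw [fun i => (families.exists_average Φ F i).choose_spec]
        exact continuous_setAverage (q := fun m i => M.toL2 (F.1 (m, i))) Φ.2.1 (families.continuous F)⟩
    map_add' := fun F G => Subtype.ext <| funext fun i => M.toL2_injective <| by
      rw [(families.exists_average Φ (F + G) i).choose_spec]
      refine Eq.trans ?_ (map_add _ _ _).symm
      rw [(families.exists_average Φ F i).choose_spec, (families.exists_average Φ G i).choose_spec,
        ← Φ.setAverage_add (families.continuous_left F i) (families.continuous_left G i)]
      simp only [← map_add]
      rfl
    map_smul' := fun r F => Subtype.ext <| funext fun i => M.toL2_injective <| by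
      rw [(families.exists_average Φ (r • F) i).choose_spec]
      refine Eq.trans ?_ (map_smul _ _ _).symm
      rw [(families.exists_average Φ F i).choose_spec, RingHom.id_apply, ← Φ.setAverage_smul]
      simp only [← map_smul]
      rfl }

theorem families.toL2_average (Φ : FolnerSet haar) (F : M.families (Γ × I)) (i : I) :
    M.toL2 ((families.average Φ F).1 i) = ⨍ m in Φ.1, M.toL2 (F.1 (m, i)) ∂haar :=
  (families.exists_average Φ F i).choose_spec

theorem families.bdd_average (Φ : FolnerSet haar) {F : M.families (Γ × I)} {C : ℝ}
    (h : ∀ p, M.Bdd C (F.1 p)) (i : I) : M.Bdd C ((families.average Φ F).1 i) :=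
  bdd_of_toL2_eq_average Φ (families.continuous_left F i) (fun m => h (m, i)) (families.toL2_average Φ F i)

theorem families.inner_average (Φ : FolnerSet haar) (F : M.families (Γ × I)) (i : I) (c : H) :
    inner ℝ c (M.toL2 ((families.average Φ F).1 i)) =
      ⨍ m in Φ.1, inner ℝ c (M.toL2 (F.1 (m, i))) ∂haar := by
  rw [families.toL2_average, Φ.inner_setAverage (families.continuous_left F i)]

end Average

end KoopmanModel

/-! ### Positive means and the Hilbert spaces of families -/

/-- A positive linear functional on the bounded continuous functions. -/
structure PositiveMean (I : Type*) [TopologicalSpace I] where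
  toLinearMap : (I →ᵇ ℝ) →ₗ[ℝ] ℝ
  nonneg : ∀ q : I →ᵇ ℝ, (∀ i, 0 ≤ q i) → 0 ≤ toLinearMap q

namespace PositiveMean

variable {I : Type*} [TopologicalSpace I] (𝔪 : PositiveMean I)

instance : CoeFun (PositiveMean I) fun _ => (I →ᵇ ℝ) → ℝ := ⟨fun 𝔪 => 𝔪.toLinearMap⟩

theorem mono {p q : I →ᵇ ℝ} (h : ∀ i, p i ≤ q i) : 𝔪 p ≤ 𝔪 q := by
  have := 𝔪.nonneg (q - p) fun i => sub_nonneg.2 (h i)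
  rwa [map_sub, sub_nonneg] at this

theorem one_nonneg : 0 ≤ 𝔪 1 := 𝔪.nonneg 1 fun _ => zero_le_one

theorem abs_le {q : I →ᵇ ℝ} {C : ℝ} (h : ∀ i, |q i| ≤ C) : |𝔪 q| ≤ C * 𝔪 1 := by
  have e : C * 𝔪 1 = 𝔪 (C • 1) := by rw [map_smul, smul_eq_mul]
  rw [_root_.abs_le, e]
  constructor
  · rw [← map_neg]
    refine 𝔪.mono fun i => ?_
    simpa using (_root_.abs_le.1 (h i)).1
  · refine 𝔪.mono fun i => ?_
    simpa using (_root_.abs_le.1 (h i)).2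

end PositiveMean

namespace KoopmanModel

variable {Γ 𝓐 H : Type*} [Group Γ] [TopologicalSpace Γ] [CommRing 𝓐] [Algebra ℝ 𝓐]
  [NormedAddCommGroup H] [InnerProductSpace ℝ H] {M : KoopmanModel Γ 𝓐 H}
  {I : Type*} [TopologicalSpace I]

theorem norm_toL2_le (M : KoopmanModel Γ 𝓐 H) {C : ℝ} {a : 𝓐} (h : M.Bdd C a) :
    ‖M.toL2 a‖ ≤ C * ‖M.toL2 1‖ := by
  simpa using M.norm_mul_le h 1

theorem families.exists_norm_le (F : M.families I) : ∃ C, 0 ≤ C ∧ ∀ i, ‖M.toL2 (F.1 i)‖ ≤ C := by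
  obtain ⟨C, hC, h⟩ := families.exists_bdd F
  exact ⟨C * ‖M.toL2 1‖, by positivity, fun i => M.norm_toL2_le (h i)⟩

/-- The pointwise inner product of two families. -/
noncomputable def families.pairing (F G : M.families I) : I →ᵇ ℝ :=
  BoundedContinuousFunction.ofNormedAddCommGroup
    (fun i => inner ℝ (M.toL2 (F.1 i)) (M.toL2 (G.1 i)))
    ((families.continuous F).inner (families.continuous G))
    ((families.exists_norm_le F).choose * (families.exists_norm_le G).choose) fun i =>
      (norm_inner_le_norm _ _).trans (mul_le_mul ((families.exists_norm_le F).choose_spec.2 i)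
        ((families.exists_norm_le G).choose_spec.2 i) (norm_nonneg _)
        (families.exists_norm_le F).choose_spec.1)

@[simp] theorem families.pairing_apply (F G : M.families I) (i : I) :
    families.pairing F G i = inner ℝ (M.toL2 (F.1 i)) (M.toL2 (G.1 i)) := rfl

theorem families.pairing_add_left (F F' G : M.families I) :
    families.pairing (F + F') G = families.pairing F G + families.pairing F' G := by
  ext i
  simp [inner_add_left]

theorem families.pairing_smul_left (r : ℝ) (F G : M.families I) :
    families.pairing (r • F) G = r • families.pairing F G := by
  ext i
  simp [inner_smul_left]

theorem families.pairing_comm (F G : M.families I) :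
    families.pairing F G = families.pairing G F := by
  ext i
  exact real_inner_comm _ _

/-- The families, as a pre-Hilbert space for the inner product given by a mean. -/
def PreL2 (M : KoopmanModel Γ 𝓐 H) {I : Type*} [TopologicalSpace I] (_ : PositiveMean I) :=
  M.families I

variable (𝔪 : PositiveMean I)

noncomputable instance : AddCommGroup (M.PreL2 𝔪) := inferInstanceAs (AddCommGroup (M.families I))
noncomputable instance : Module ℝ (M.PreL2 𝔪) := inferInstanceAs (Module ℝ (M.families I))

/-- The inner product on families given by a mean. -/
noncomputable abbrev preL2Core : PreInnerProductSpace.Core ℝ (M.PreL2 𝔪) where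
  inner F G := 𝔪 (families.pairing (M := M) F G)
  conj_inner_symm _ _ := congrArg 𝔪 (families.pairing_comm _ _)
  re_inner_nonneg _ := 𝔪.nonneg _ fun _ => real_inner_self_nonneg
  add_left _ _ _ :=
    (congrArg 𝔪 (families.pairing_add_left _ _ _)).trans (map_add 𝔪.toLinearMap _ _)
  smul_left _ _ _ :=
    (congrArg 𝔪 (families.pairing_smul_left _ _ _)).trans (map_smul 𝔪.toLinearMap _ _)

noncomputable instance : SeminormedAddCommGroup (M.PreL2 𝔪) :=
  InnerProductSpace.Core.toSeminormedAddCommGroup (c := preL2Core 𝔪)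

noncomputable instance : InnerProductSpace ℝ (M.PreL2 𝔪) :=
  InnerProductSpace.ofCore (preL2Core 𝔪)

/-- The Hilbert space of families given by a mean. -/
def L2 (M : KoopmanModel Γ 𝓐 H) {I : Type*} [TopologicalSpace I] (𝔪 : PositiveMean I) :=
  UniformSpace.Completion (M.PreL2 𝔪)

noncomputable instance : NormedAddCommGroup (M.L2 𝔪) :=
  inferInstanceAs (NormedAddCommGroup (UniformSpace.Completion (M.PreL2 𝔪)))

noncomputable instance : InnerProductSpace ℝ (M.L2 𝔪) :=
  inferInstanceAs (InnerProductSpace ℝ (UniformSpace.Completion (M.PreL2 𝔪)))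

instance : CompleteSpace (M.L2 𝔪) :=
  inferInstanceAs (CompleteSpace (UniformSpace.Completion (M.PreL2 𝔪)))

/-- The map from families to their Hilbert space. -/
noncomputable def cls (𝔪 : PositiveMean I) : M.families I →ₗ[ℝ] M.L2 𝔪 :=
  (UniformSpace.Completion.toComplₗᵢ (𝕜 := ℝ) (E := M.PreL2 𝔪)).toLinearMap

theorem inner_cls (F G : M.families I) :
    inner ℝ (cls 𝔪 F) (cls 𝔪 G) = 𝔪 (families.pairing F G) :=
  UniformSpace.Completion.inner_coe (𝕜 := ℝ) (E := M.PreL2 𝔪) F G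

theorem norm_cls_sq (F : M.families I) : ‖cls 𝔪 F‖ ^ 2 = 𝔪 (families.pairing F F) := by
  rw [← real_inner_self_eq_norm_sq, inner_cls]

theorem denseRange_cls : DenseRange (cls (M := M) 𝔪) :=
  UniformSpace.Completion.denseRange_coe (α := M.PreL2 𝔪)

/-- Positivity of the mean integrates a pointwise L² inequality. It serves both to extend
`averageOp` to the completion and to bound the dual function. -/
theorem norm_cls_le_of_le (𝔪 : PositiveMean I)
    {F G : M.families I} {C : ℝ} (hC : 0 ≤ C)
    (h : ∀ i, ‖M.toL2 (F.1 i)‖ ≤ C * ‖M.toL2 (G.1 i)‖) : ‖cls 𝔪 F‖ ≤ C * ‖cls 𝔪 G‖ := by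
  refine le_of_sq_le_sq ?_ (by positivity)
  rw [mul_pow, norm_cls_sq, norm_cls_sq, ← smul_eq_mul, ← map_smul]
  refine 𝔪.mono fun i => ?_
  have h2 := pow_le_pow_left₀ (norm_nonneg _) (h i) 2
  rw [mul_pow] at h2
  simpa [real_inner_self_eq_norm_sq] using h2

/-! ### Enlarging the index space and the mean -/

section Extension

variable [T2Space Γ] [LocallyCompactSpace Γ] [MeasurableSpace Γ] [BorelSpace Γ]
  {haar : Measure Γ} [IsFiniteMeasureOnCompacts haar]

/-- The index set obtained from `I` by adding a compact set and a group element. -/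
abbrev Extend (haar : Measure Γ) (I : Type*) := Σ _ : FolnerSet haar, Γ × I

/-- The point of the group of an index. -/
def Extend.point : C(Extend haar I, Γ) := ⟨fun x => x.2.1, by
  rw [continuous_sigma_iff]; intro _; fun_prop⟩

/-- The original index. -/
def Extend.base : C(Extend haar I, I) := ⟨fun x => x.2.2, by
  rw [continuous_sigma_iff]; intro _; fun_prop⟩

/-- The inclusion of the part of the extended index set that belongs to a given compact set. -/
def Extend.incl (Φ : FolnerSet haar) : C(Γ × I, Extend haar I) := ⟨fun p => ⟨Φ, p⟩,
  continuous_sigmaMk (σ := fun _ : FolnerSet haar => Γ × I)⟩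

/-- The averages of a bounded continuous function over a compact set. -/
noncomputable def averageBCF (Φ : FolnerSet haar) : (Extend haar I →ᵇ ℝ) →ₗ[ℝ] (I →ᵇ ℝ) where
  toFun q := BoundedContinuousFunction.ofNormedAddCommGroup
    (fun i => ⨍ m in Φ.1, q ⟨Φ, m, i⟩ ∂haar)
    (continuous_setAverage (q := fun m i => q ⟨Φ, m, i⟩) Φ.2.1
      (q.continuous.comp (Extend.incl Φ).continuous)) ‖q‖
    fun _ => Φ.norm_setAverage_le fun _ _ => q.norm_coe_le_norm _
  map_add' p q := by
    ext i
    exact Φ.setAverage_add (p.continuous.comp ((Extend.incl Φ).continuous.comp (Continuous.prodMk_left i)))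
      (q.continuous.comp ((Extend.incl Φ).continuous.comp (Continuous.prodMk_left i)))
  map_smul' r q := by
    ext i
    exact Φ.setAverage_smul r _

@[simp] theorem averageBCF_apply (Φ : FolnerSet haar) (q : Extend haar I →ᵇ ℝ) (i : I) :
    averageBCF Φ q i = ⨍ m in Φ.1, q ⟨Φ, m, i⟩ ∂haar := rfl

theorem exists_tendsto_averageBCF (U : Ultrafilter (FolnerSet haar)) (q : Extend haar I →ᵇ ℝ) :
    ∃ L, Tendsto (fun Φ => 𝔪 (averageBCF Φ q)) U (𝓝 L) := by
  have h : ∀ Φ, 𝔪 (averageBCF Φ q) ∈ Set.Icc (-(‖q‖ * 𝔪 1)) (‖q‖ * 𝔪 1) := fun Φ =>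
    abs_le.1 (𝔪.abs_le fun i => Φ.norm_setAverage_le fun _ _ => q.norm_coe_le_norm _)
  -- The values lie in a fixed compact interval, where an ultrafilter always converges.
  obtain ⟨L, -, hL⟩ := isCompact_Icc.ultrafilter_le_nhds (U.map fun Φ => 𝔪 (averageBCF Φ q))
    (le_principal_iff.2 (Eventually.of_forall (f := (U : Filter (FolnerSet haar))) h))
  exact ⟨L, hL⟩

/-- The mean on the extended index set. -/
noncomputable def extendMean (U : Ultrafilter (FolnerSet haar)) :
    PositiveMean (Extend haar I) where
  toLinearMap :=
    { toFun := fun q => (exists_tendsto_averageBCF 𝔪 U q).choose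
      map_add' := fun p q => by
        refine tendsto_nhds_unique (exists_tendsto_averageBCF 𝔪 U (p + q)).choose_spec ?_
        simpa using (exists_tendsto_averageBCF 𝔪 U p).choose_spec.add
          (exists_tendsto_averageBCF 𝔪 U q).choose_spec
      map_smul' := fun r q => by
        refine tendsto_nhds_unique (exists_tendsto_averageBCF 𝔪 U (r • q)).choose_spec ?_
        simpa using (exists_tendsto_averageBCF 𝔪 U q).choose_spec.const_mul r }
  nonneg q hq := ge_of_tendsto' (exists_tendsto_averageBCF 𝔪 U q).choose_spec fun Φ =>
    𝔪.nonneg _ fun _ => Φ.setAverage_nonneg fun _ => hq _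

theorem tendsto_extendMean (U : Ultrafilter (FolnerSet haar)) (q : Extend haar I →ᵇ ℝ) :
    Tendsto (fun Φ => 𝔪 (averageBCF Φ q)) U (𝓝 (extendMean 𝔪 U q)) :=
  (exists_tendsto_averageBCF 𝔪 U q).choose_spec

/-- Averaging over m does nothing to a function independent of Φ and m. Hence the extended mean
restricts to the old one and `inclusion` is isometric. -/
theorem extendMean_eq_of_base (U : Ultrafilter (FolnerSet haar)) {q : Extend haar I →ᵇ ℝ}
    {p : I →ᵇ ℝ} (h : ∀ x, q x = p (Extend.base x)) : extendMean 𝔪 U q = 𝔪 p := by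
  refine tendsto_nhds_unique (tendsto_extendMean 𝔪 U q) ?_
  refine tendsto_const_nhds.congr fun Φ => congrArg 𝔪 ?_
  ext i
  simp only [averageBCF_apply, h]
  exact (Φ.setAverage_const (p i)).symm

/-- The inclusion of the Hilbert space of families in the Hilbert space of extended families. -/
noncomputable def inclusion (U : Ultrafilter (FolnerSet haar)) :
    M.L2 𝔪 →L[ℝ] M.L2 (extendMean 𝔪 U) :=
  ((cls (extendMean 𝔪 U)).comp (families.pull Extend.base).toLinearMap).extendOfNorm (cls 𝔪)

theorem inner_cls_pull (U : Ultrafilter (FolnerSet haar)) (F G : M.families I) :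
    inner ℝ (cls (extendMean 𝔪 U) (families.pull Extend.base F))
      (cls (extendMean 𝔪 U) (families.pull Extend.base G)) = inner ℝ (cls 𝔪 F) (cls 𝔪 G) := by
  rw [inner_cls, inner_cls]
  exact extendMean_eq_of_base 𝔪 U fun _ => rfl

theorem inclusion_cls (U : Ultrafilter (FolnerSet haar)) (F : M.families I) :
    inclusion 𝔪 U (cls 𝔪 F) = cls (extendMean 𝔪 U) (families.pull Extend.base F) := by
  have h (G : M.families I) : ‖((cls (extendMean 𝔪 U)).comp
      (families.pull (M := M) Extend.base).toLinearMap) G‖ ≤ 1 * ‖cls 𝔪 G‖ := by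
    rw [one_mul, ← sq_le_sq₀ (norm_nonneg _) (norm_nonneg _), ← real_inner_self_eq_norm_sq,
      ← real_inner_self_eq_norm_sq]
    exact (inner_cls_pull 𝔪 U G G).le
  have hd : DenseRange (cls (M := M) 𝔪) := denseRange_cls 𝔪
  exact LinearMap.extendOfNorm_eq hd ⟨1, h⟩ F

theorem norm_inclusion_le (U : Ultrafilter (FolnerSet haar)) (w : M.L2 𝔪) :
    ‖inclusion 𝔪 U w‖ ≤ ‖w‖ := by
  refine (denseRange_cls 𝔪).induction_on w
    (isClosed_le (by fun_prop) (by fun_prop)) fun F => ?_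
  rw [inclusion_cls, ← sq_le_sq₀ (norm_nonneg _) (norm_nonneg _), ← real_inner_self_eq_norm_sq,
    ← real_inner_self_eq_norm_sq, inner_cls_pull]

end Extension

end KoopmanModel

/-! ### Multiple averages as operators in the last factor -/

namespace KoopmanModel

variable {Γ 𝓐 H : Type*} [Group Γ] [TopologicalSpace Γ] [CommRing 𝓐] [Algebra ℝ 𝓐]
  [NormedAddCommGroup H] [InnerProductSpace ℝ H] {M : KoopmanModel Γ 𝓐 H}
  {I : Type*} [TopologicalSpace I]

/-- The product `(m, i) ↦ ∏_{k < n} S_k(m) f_k(i)`. -/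
noncomputable def productKernel (n : ℕ) (f : ℕ → M.families I) : M.families (Γ × I) :=
  ∏ k ∈ Finset.range n, families.twist k ContinuousMap.fst (families.pull ContinuousMap.snd (f k))

theorem productKernel_apply (n : ℕ) (f : ℕ → M.families I) (p : Γ × I) :
    (productKernel n f).1 p = ∏ k ∈ Finset.range n, M.partialAct k p.1 ((f k).1 p.2) := by
  rw [productKernel, families.prod_apply]
  rfl

section

variable [CompleteSpace H] [T2Space Γ] [LocallyCompactSpace Γ] [MeasurableSpace Γ] [BorelSpace Γ]
  {haar : Measure Γ} [IsFiniteMeasureOnCompacts haar]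

/-- The multiple ergodic averages of `n` families. -/
noncomputable def multiAverage (Φ : FolnerSet haar) (n : ℕ) (f : ℕ → M.families I) :
    M.families I :=
  families.average Φ (productKernel n f)

/-- The multiple ergodic average as a function of its last argument. -/
noncomputable def averageOp (Φ : FolnerSet haar) (n : ℕ) (f : ℕ → M.families I) :
    M.families I →ₗ[ℝ] M.families I :=
  families.average Φ ∘ₗ LinearMap.mulLeft ℝ (productKernel n f) ∘ₗ
    (families.twist n ContinuousMap.fst).toLinearMap ∘ₗ
      (families.pull ContinuousMap.snd).toLinearMap

theorem averageOp_apply (Φ : FolnerSet haar) (n : ℕ) (f : ℕ → M.families I) (g : M.families I) :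
    averageOp Φ n f g = families.average Φ (productKernel n f *
      families.twist n ContinuousMap.fst (families.pull ContinuousMap.snd g)) := rfl

theorem multiAverage_succ (Φ : FolnerSet haar) (n : ℕ) (f : ℕ → M.families I) :
    multiAverage Φ (n + 1) f = averageOp Φ n f (f n) := by
  rw [multiAverage, productKernel, Finset.prod_range_succ]
  rfl

theorem norm_averageOp_le (Φ : FolnerSet haar) {n : ℕ} {f : ℕ → M.families I} {C : ℝ}
    (hC : ∀ p, M.Bdd C ((productKernel n f).1 p)) (g : M.families I) (i : I) :
    ‖M.toL2 ((averageOp Φ n f g).1 i)‖ ≤ C * ‖M.toL2 (g.1 i)‖ := by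
  rw [averageOp_apply, families.toL2_average]
  refine Φ.norm_setAverage_le fun m _ => (M.norm_mul_le (hC (m, i)) _).trans ?_
  rw [families.twist_apply, norm_partialAct]
  rfl

theorem bdd_averageOp (Φ : FolnerSet haar) {n : ℕ} {f : ℕ → M.families I} {C D : ℝ}
    (hC : ∀ p, M.Bdd C ((productKernel n f).1 p)) {g : M.families I} (hD : ∀ i, M.Bdd D (g.1 i))
    (i : I) : M.Bdd (C * D) ((averageOp Φ n f g).1 i) := by
  rw [averageOp_apply]
  exact families.bdd_average Φ (fun p => M.bdd_mul (hC p) (M.bdd_partialAct n _ (hD _))) i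

variable [IsTopologicalGroup Γ]

/-- The adjoint of `averageOp`. -/
noncomputable def averageAdj (Φ : FolnerSet haar) (n : ℕ) (f : ℕ → M.families I)
    (x : M.families I) : M.families I :=
  families.average Φ (families.twist n (ContinuousMap.fst)⁻¹
    (productKernel n f * families.pull ContinuousMap.snd x))

/-- Multiplication by a real function is symmetric, and the isometry S_n(m) has inverse, hence
adjoint, S_n(m⁻¹). -/
theorem inner_averageAdj (Φ : FolnerSet haar) (n : ℕ) (f : ℕ → M.families I)
    (g x : M.families I) (i : I) :
    inner ℝ (M.toL2 (g.1 i)) (M.toL2 ((averageAdj Φ n f x).1 i)) =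
      inner ℝ (M.toL2 ((averageOp Φ n f g).1 i)) (M.toL2 (x.1 i)) := by
  rw [averageAdj, families.inner_average, real_inner_comm, averageOp_apply,
    families.inner_average]
  congr 1
  ext m
  simp only [families.twist_apply, ContinuousMap.inv_apply, inner_partialAct_inv]
  rw [real_inner_comm]
  exact M.inner_mul _ _ _

theorem pairing_averageAdj (Φ : FolnerSet haar) (n : ℕ) (f : ℕ → M.families I)
    (g x : M.families I) :
    families.pairing g (averageAdj Φ n f x) = families.pairing (averageOp Φ n f g) x := by
  ext i
  exact inner_averageAdj Φ n f g x i

section Operators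

variable (𝔪 : PositiveMean I)

/-- The extension of `averageOp` to the Hilbert space. -/
noncomputable def averageCLM (Φ : FolnerSet haar) (n : ℕ) (f : ℕ → M.families I) :
    M.L2 𝔪 →L[ℝ] M.L2 𝔪 :=
  ((cls 𝔪).comp (averageOp Φ n f)).extendOfNorm (cls 𝔪)

theorem norm_cls_averageOp_le (Φ : FolnerSet haar) {n : ℕ} {f : ℕ → M.families I} {C : ℝ}
    (hC0 : 0 ≤ C) (hC : ∀ p, M.Bdd C ((productKernel n f).1 p)) (g : M.families I) :
    ‖((cls 𝔪).comp (averageOp Φ n f)) g‖ ≤ C * ‖cls 𝔪 g‖ :=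
  norm_cls_le_of_le 𝔪 hC0 (norm_averageOp_le Φ hC g)

theorem averageCLM_cls (Φ : FolnerSet haar) (n : ℕ) (f : ℕ → M.families I) (g : M.families I) :
    averageCLM 𝔪 Φ n f (cls 𝔪 g) = cls 𝔪 (averageOp Φ n f g) := by
  obtain ⟨C, hC0, hC⟩ := families.exists_bdd (productKernel n f)
  have hd : DenseRange (cls (M := M) 𝔪) := denseRange_cls 𝔪
  exact LinearMap.extendOfNorm_eq hd ⟨C, norm_cls_averageOp_le 𝔪 Φ hC0 hC⟩ g

theorem norm_averageCLM_le (Φ : FolnerSet haar) {n : ℕ} {f : ℕ → M.families I} {C : ℝ}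
    (hC0 : 0 ≤ C) (hC : ∀ p, M.Bdd C ((productKernel n f).1 p)) (w : M.L2 𝔪) :
    ‖averageCLM 𝔪 Φ n f w‖ ≤ C * ‖w‖ := by
  have hd : DenseRange (cls (M := M) 𝔪) := denseRange_cls 𝔪
  exact LinearMap.norm_extendOfNorm_apply_le hd C (norm_cls_averageOp_le 𝔪 Φ hC0 hC) w

theorem inner_averageCLM (Φ : FolnerSet haar) (n : ℕ) (f : ℕ → M.families I) (w : M.L2 𝔪)
    (x : M.families I) :
    inner ℝ (averageCLM 𝔪 Φ n f w) (cls 𝔪 x) = inner ℝ w (cls 𝔪 (averageAdj Φ n f x)) := by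
  have hd : DenseRange (cls (M := M) 𝔪) := denseRange_cls 𝔪
  refine hd.induction_on w (isClosed_eq (by fun_prop) (by fun_prop)) fun g => ?_
  rw [averageCLM_cls, inner_cls, inner_cls, pairing_averageAdj]

end Operators

/-! ### Dual functions -/

section Dual

/-- The family on the extended index set given by uniformly bounded families. -/
def families.glue (u : FolnerSet haar → M.families I)
    (hu : ∃ C, 0 ≤ C ∧ ∀ Φ i, M.Bdd C ((u Φ).1 i)) : M.families (Extend haar I) :=
  ⟨fun x => (u x.1).1 x.2.2, hu.imp fun _ h => ⟨h.1, fun _ => h.2 _ _⟩,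
    continuous_sigma_iff.2 fun Φ => (families.continuous (u Φ)).comp continuous_snd⟩

/-- The factor with index `k` of the dual function, without its group elements. -/
noncomputable def dualFactor (f : ℕ → M.families I) (v : M.families (Extend haar I)) (k : ℕ) :
    M.families (Extend haar I) :=
  (if k = 0 then v else 1) * families.pull Extend.base (f k)

/-- The family `(Φ, m, i) ↦ S_n(m⁻¹) S_k(m) b(Φ, m, i)`. -/
noncomputable def dualTwist (n k : ℕ) (b : M.families (Extend haar I)) :
    M.families (Extend haar I) :=
  families.twist n (Extend.point)⁻¹ (families.twist k Extend.point b)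

/-- The dual function of the multiple averages. -/
noncomputable def dualFunction (n : ℕ) (f : ℕ → M.families I) (v : M.families (Extend haar I)) :
    M.families (Extend haar I) :=
  ∏ k ∈ Finset.range n, dualTwist n k (dualFactor f v k)

/-- The extra function v is absorbed in the factor k = 0, where S_0 is the identity; this is why at
least one factor is required. -/
theorem dualFunction_apply {n : ℕ} (hn : n ≠ 0) (f : ℕ → M.families I)
    (v : M.families (Extend haar I)) (Φ : FolnerSet haar) (m : Γ) (i : I) :
    (dualFunction n f v).1 ⟨Φ, m, i⟩ =
      M.partialAct n m⁻¹ ((productKernel n f).1 (m, i) * v.1 ⟨Φ, m, i⟩) := by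
  have h (k : ℕ) : (dualTwist n k (dualFactor f v k)).1 ⟨Φ, m, i⟩ = M.partialAct n m⁻¹
      ((if k = 0 then v.1 ⟨Φ, m, i⟩ else 1) * M.partialAct k m ((f k).1 i)) := by
    refine congrArg (M.partialAct n m⁻¹) ?_
    refine (map_mul (M.partialAct k m) _ _).trans ?_
    by_cases hk : k = 0
    · subst hk
      simp only [if_true]
      rfl
    · simp only [if_neg hk]
      exact congrArg (· * _) (map_one _)
  rw [dualFunction, families.prod_apply]
  simp only [h]
  rw [← map_prod, Finset.prod_mul_distrib, Finset.prod_ite_eq',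
    if_pos (Finset.mem_range.2 (Nat.pos_of_ne_zero hn)), productKernel_apply, mul_comm]

/-- Apply `partialAct_translate` factor by factor. The variable l now occurs only through S_k(l)
with k < n, so one factor has disappeared from the average over l. -/
theorem partialAct_dualFunction (n : ℕ) (f : ℕ → M.families I) (u : FolnerSet haar → M.families I)
    (hu : ∃ C, 0 ≤ C ∧ ∀ Φ i, M.Bdd C ((u Φ).1 i)) (Φ : FolnerSet haar) (l m : Γ) (i : I) :
    M.partialAct n l ((dualFunction n f (families.glue u hu)).1 ⟨Φ, l * m, i⟩) =
      ∏ k ∈ Finset.range n, M.partialAct k l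
        ((dualTwist n k (dualFactor f (families.glue u hu) k)).1 ⟨Φ, m, i⟩) := by
  rw [dualFunction, families.prod_apply, map_prod]
  refine Finset.prod_congr rfl fun k hk => ?_
  -- The undifferentiated factors depend on Φ and i but not on the group element, so shifting m
  -- leaves them unchanged.
  have hb : (dualFactor f (families.glue u hu) k).1 ⟨Φ, l * m, i⟩ =
      (dualFactor f (families.glue u hu) k).1 ⟨Φ, m, i⟩ := by
    simp only [dualFactor]
    split_ifs <;> rfl
  refine Eq.trans ?_ (DFunLike.congr_fun (M.partialAct_translate (Finset.mem_range.1 hk).le l m)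
    ((dualFactor f (families.glue u hu) k).1 ⟨Φ, m, i⟩))
  rw [← hb]
  rfl

variable (𝔪 : PositiveMean I)

/-- Moving A_Φ to the other side by its adjoint gives exactly the quantity whose limit along U
defines the extended mean. -/
theorem tendsto_inner_dualFunction {n : ℕ} (hn : n ≠ 0) (f : ℕ → M.families I)
    (u : FolnerSet haar → M.families I) (hu : ∃ C, 0 ≤ C ∧ ∀ Φ i, M.Bdd C ((u Φ).1 i))
    (U : Ultrafilter (FolnerSet haar)) (g : M.families I) :
    Tendsto (fun Φ => inner ℝ (averageCLM 𝔪 Φ n f (cls 𝔪 g)) (cls 𝔪 (u Φ))) U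
      (𝓝 (inner ℝ (inclusion 𝔪 U (cls 𝔪 g))
        (cls (extendMean 𝔪 U) (dualFunction n f (families.glue u hu))))) := by
  rw [inclusion_cls, inner_cls]
  refine (tendsto_extendMean 𝔪 U _).congr fun Φ => ?_
  rw [inner_averageCLM, inner_cls]
  congr 1
  ext i
  rw [averageBCF_apply, families.pairing_apply, averageAdj, families.inner_average]
  congr 1
  ext m
  rw [families.pairing_apply, dualFunction_apply hn]
  rfl

theorem norm_dualFunction_le {n : ℕ} (hn : n ≠ 0) (f : ℕ → M.families I)
    (u : FolnerSet haar → M.families I) (hu : ∃ C, 0 ≤ C ∧ ∀ Φ i, M.Bdd C ((u Φ).1 i))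
    (U : Ultrafilter (FolnerSet haar)) {C D : ℝ} (hC0 : 0 ≤ C)
    (hC : ∀ p, M.Bdd C ((productKernel n f).1 p)) (hD0 : 0 ≤ D) {g : M.families I}
    (hg : ∀ Φ i, ‖M.toL2 ((u Φ).1 i)‖ ≤ D * ‖M.toL2 (g.1 i)‖) :
    ‖cls (extendMean 𝔪 U) (dualFunction n f (families.glue u hu))‖ ≤ C * D * ‖cls 𝔪 g‖ := by
  have h := norm_inclusion_le 𝔪 U (cls 𝔪 g)
  rw [inclusion_cls] at h
  refine le_trans ?_ (mul_le_mul_of_nonneg_left h (by positivity))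
  refine norm_cls_le_of_le _ (by positivity) ?_
  rintro ⟨Φ, m, i⟩
  rw [dualFunction_apply hn, norm_partialAct, mul_assoc]
  exact (M.norm_mul_le (hC _) _).trans (mul_le_mul_of_nonneg_left (hg Φ i) hC0)

/-- This and `averageBCF_multiAverage` write the two sides of the comparison as the same double
average, at the points m and lm respectively, ready for the Følner estimate. -/
theorem averageBCF_dualFunction_averageAdj (n : ℕ) (f : ℕ → M.families I)
    (v : M.families (Extend haar I)) (Φ Ψ : FolnerSet haar) (x : M.families I) (i : I) :
    averageBCF Φ (families.pairing (dualFunction n f v)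
        (families.pull Extend.base (averageAdj Ψ n f x))) i =
      ⨍ m in Φ.1, ⨍ l in Ψ.1, inner ℝ (M.toL2 (x.1 i)) (M.toL2 ((productKernel n f).1 (l, i) *
        M.partialAct n l ((dualFunction n f v).1 ⟨Φ, m, i⟩))) ∂haar ∂haar := by
  rw [averageBCF_apply]
  congr 1
  ext m
  rw [families.pairing_apply, families.pull_apply, averageAdj, families.inner_average]
  congr 1
  ext l
  rw [families.twist_apply, ContinuousMap.inv_apply, inner_partialAct_inv]
  exact (M.inner_mul _ _ _).symm.trans (real_inner_comm _ _)

theorem averageBCF_multiAverage (n : ℕ) (f : ℕ → M.families I)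
    (u : FolnerSet haar → M.families I) (hu : ∃ C, 0 ≤ C ∧ ∀ Φ i, M.Bdd C ((u Φ).1 i))
    (Φ Ψ : FolnerSet haar) (x : M.families I) (i : I) :
    averageBCF Φ (families.pairing (multiAverage Ψ n fun k => families.pull Extend.base (f k) *
        dualTwist n k (dualFactor f (families.glue u hu) k)) (families.pull Extend.base x)) i =
      ⨍ m in Φ.1, ⨍ l in Ψ.1, inner ℝ (M.toL2 (x.1 i)) (M.toL2 ((productKernel n f).1 (l, i) *
        M.partialAct n l ((dualFunction n f (families.glue u hu)).1 ⟨Φ, l * m, i⟩))) ∂haar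
        ∂haar := by
  rw [averageBCF_apply]
  congr 1
  ext m
  rw [families.pairing_apply, families.pull_apply, multiAverage, real_inner_comm,
    families.inner_average]
  congr 1
  ext l
  rw [partialAct_dualFunction, productKernel_apply, productKernel_apply,
    ← Finset.prod_mul_distrib]
  simp only [← map_mul]
  rfl

end Dual

end

end KoopmanModel

/-- The operators are equicontinuous, so approximating x by a point of convergence makes the net at
x Cauchy. -/
theorem isClosed_setOf_tendsto {ι E F : Type*} [NormedAddCommGroup E] [NormedSpace ℝ E]
    [NormedAddCommGroup F] [NormedSpace ℝ F] [CompleteSpace F] {l : Filter ι} [l.NeBot]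
    (T : ι → E →L[ℝ] F) {C : ℝ} (hC0 : 0 ≤ C) (hC : ∀ i x, ‖T i x‖ ≤ C * ‖x‖) :
    IsClosed {x | ∃ L, Tendsto (fun i => T i x) l (𝓝 L)} := by
  refine isClosed_of_closure_subset fun x hx => ?_
  refine (cauchy_map_iff_exists_tendsto (l := l) (f := fun i => T i x)).1 ?_
  rw [Metric.cauchy_iff]
  refine ⟨inferInstance, fun ε hε => ?_⟩
  obtain ⟨y, ⟨L, hL⟩, hxy⟩ := Metric.mem_closure_iff.1 hx (ε / (4 * (C + 1))) (by positivity)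
  refine ⟨_, image_mem_map (hL (Metric.ball_mem_nhds L (by positivity : 0 < ε / 4))), ?_⟩
  have h : ∀ i, dist (T i x) (T i y) ≤ ε / 4 := fun i => by
    rw [dist_eq_norm, ← map_sub]
    refine (hC i _).trans ?_
    rw [dist_eq_norm, lt_div_iff₀ (by positivity)] at hxy
    nlinarith [norm_nonneg (x - y)]
  rintro _ ⟨i, hi, rfl⟩ _ ⟨k, hk, rfl⟩
  have h1 : dist (T i y) L < ε / 4 := hi
  have h2 : dist (T k y) L < ε / 4 := hk
  have h3 := dist_triangle4 (T i x) (T i y) L (T k x)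
  have h4 := dist_triangle L (T k y) (T k x)
  have h5 := h i
  have h6 := h k
  rw [dist_comm] at h6 h2
  change dist (T i x) (T k x) < ε
  linarith

/-! ### The inductive step -/

namespace KoopmanModel

variable {Γ 𝓐 H : Type*} [Group Γ] [TopologicalSpace Γ] [CommRing 𝓐] [Algebra ℝ 𝓐]
  [NormedAddCommGroup H] [InnerProductSpace ℝ H] {M : KoopmanModel Γ 𝓐 H}
  {I : Type*} [TopologicalSpace I]
  [CompleteSpace H] [T2Space Γ] [LocallyCompactSpace Γ] [MeasurableSpace Γ] [BorelSpace Γ]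
  [IsTopologicalGroup Γ]
  {haar : Measure Γ} [IsFiniteMeasureOnCompacts haar] [haar.IsMulLeftInvariant]
  (𝔪 : PositiveMean I)

/-- After exchanging the averages, l is fixed while m runs over Φ, and the two inner averages differ
by the left translation by l. The constant B is uniform in Φ, Ψ and i because all families are
bounded. -/
theorem exists_abs_average_sub_translate_le (n : ℕ) (f : ℕ → M.families I)
    (v : M.families (Extend haar I)) (x : M.families I) :
    ∃ B, 0 ≤ B ∧ ∀ (Φ Ψ : FolnerSet haar) (δ : ℝ),
      (∀ l ∈ Ψ.1, haar.real ((l • Φ.1) ∆ Φ.1) ≤ δ * haar.real Φ.1) → ∀ i,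
      |(⨍ m in Φ.1, ⨍ l in Ψ.1, inner ℝ (M.toL2 (x.1 i)) (M.toL2 ((productKernel n f).1 (l, i) *
          M.partialAct n l (v.1 ⟨Φ, l * m, i⟩))) ∂haar ∂haar) -
        ⨍ m in Φ.1, ⨍ l in Ψ.1, inner ℝ (M.toL2 (x.1 i)) (M.toL2 ((productKernel n f).1 (l, i) *
          M.partialAct n l (v.1 ⟨Φ, m, i⟩))) ∂haar ∂haar| ≤ B * δ := by
  let W : M.families (Γ × Extend haar I) :=
    families.pull (ContinuousMap.prodMk ContinuousMap.fst
      (Extend.base.comp ContinuousMap.snd)) (productKernel n f) *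
    families.twist n ContinuousMap.fst (families.pull ContinuousMap.snd v)
  obtain ⟨C, hC0, hC⟩ := families.exists_norm_le x
  obtain ⟨D, hD0, hD⟩ := families.exists_norm_le W
  refine ⟨C * D, by positivity, fun Φ Ψ δ hδ i => ?_⟩
  let Q : Γ → Γ → ℝ := fun l m => inner ℝ (M.toL2 (x.1 i)) (M.toL2 (W.1 (l, ⟨Φ, m, i⟩)))
  have hQ : Continuous Q.uncurry := by
    have h1 : Continuous fun p : Γ × Γ => (p.1, (⟨Φ, p.2, i⟩ : Extend haar I)) :=
      continuous_fst.prodMk ((Extend.incl Φ).continuous.comp (continuous_snd.prodMk continuous_const))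
    exact continuous_const.inner ((families.continuous W).comp h1)
  have hQ' : Continuous (fun l m => Q l (l * m)).uncurry :=
    hQ.comp (continuous_fst.prodMk (continuous_fst.mul continuous_snd))
  have hB : ∀ l m, |Q l m| ≤ C * D := fun l m =>
    (abs_real_inner_le_norm _ _).trans (mul_le_mul (hC _) (hD _) (norm_nonneg _) hC0)
  change |(⨍ m in Φ.1, ⨍ l in Ψ.1, Q l (l * m) ∂haar ∂haar) -
    ⨍ m in Φ.1, ⨍ l in Ψ.1, Q l m ∂haar ∂haar| ≤ _
  rw [← Φ.setAverage_swap Ψ hQ, ← Φ.setAverage_swap Ψ hQ', ← Ψ.setAverage_sub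
    (continuous_setAverage (q := fun m l => Q l (l * m)) Φ.2.1 (hQ'.comp continuous_swap))
    (continuous_setAverage (q := fun m l => Q l m) Φ.2.1 (hQ.comp continuous_swap))]
  rw [← Real.norm_eq_abs]
  refine Ψ.norm_setAverage_le fun l hl => ?_
  exact Φ.abs_setAverage_translate_le (hQ.comp (Continuous.prodMk_right l)) (hB l) l (hδ l hl)

theorem inner_averageCLM_dualFunction (n : ℕ) (f : ℕ → M.families I)
    (u : FolnerSet haar → M.families I) (hu : ∃ C, 0 ≤ C ∧ ∀ Φ i, M.Bdd C ((u Φ).1 i))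
    {U : Ultrafilter (FolnerSet haar)} (hU : (U : Filter (FolnerSet haar)) ≤ folnerFilter haar)
    (Ψ : FolnerSet haar) (x : M.families I) :
    inner ℝ (cls (extendMean 𝔪 U) (dualFunction n f (families.glue u hu)))
      (inclusion 𝔪 U (cls 𝔪 (averageAdj Ψ n f x))) =
    inner ℝ (cls (extendMean 𝔪 U) (multiAverage Ψ n fun k => families.pull Extend.base (f k) *
        dualTwist n k (dualFactor f (families.glue u hu) k))) (inclusion 𝔪 U (cls 𝔪 x)) := by
  rw [inclusion_cls, inclusion_cls, inner_cls, inner_cls]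
  obtain ⟨B, hB0, hB⟩ := exists_abs_average_sub_translate_le n f
    (dualFunction n f (families.glue u hu)) x
  have h := (tendsto_extendMean 𝔪 U (families.pairing (multiAverage Ψ n fun k =>
    families.pull Extend.base (f k) * dualTwist n k (dualFactor f (families.glue u hu) k))
    (families.pull Extend.base x))).sub (tendsto_extendMean 𝔪 U (families.pairing
      (dualFunction n f (families.glue u hu)) (families.pull Extend.base (averageAdj Ψ n f x))))
  refine (sub_eq_zero.1 (tendsto_nhds_unique h ?_)).symm
  rw [Metric.tendsto_nhds]
  intro ε hε
  have h1 := 𝔪.one_nonneg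
  -- The tolerance δ makes B * δ * 𝔪 1 at most ε / 2; adding 1 to B and to 𝔪 1 keeps the
  -- denominators positive.
  filter_upwards [hU (eventually_folnerFilter Ψ.2.1
    (by positivity : 0 < ε / (2 * (B + 1) * (𝔪 1 + 1))))] with Φ hΦ
  rw [Real.dist_0_eq_abs, ← map_sub]
  refine (𝔪.abs_le (C := B * (ε / (2 * (B + 1) * (𝔪 1 + 1)))) fun i => ?_).trans_lt ?_
  · have h2 := hB Φ Ψ _ hΦ i
    rwa [← averageBCF_dualFunction_averageAdj, ← averageBCF_multiAverage] at h2
  · have : B * (ε / (2 * (B + 1) * (𝔪 1 + 1))) * 𝔪 1 =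
        (B / (B + 1)) * (𝔪 1 / (𝔪 1 + 1)) * (ε / 2) := by field_simp
    rw [this]
    have h3 : B / (B + 1) ≤ 1 := (div_le_one (by positivity)).2 (by linarith)
    have h4 : 𝔪 1 / (𝔪 1 + 1) ≤ 1 := (div_le_one (by positivity)).2 (by linarith)
    have h5 : B / (B + 1) * (𝔪 1 / (𝔪 1 + 1)) ≤ 1 := mul_le_one₀ h3 (by positivity) h4
    nlinarith

/-- Weak form of `inner_averageCLM_dualFunction`, tested on the dense set of classes of families. It
turns an average with a last factor into the conditional expectation of an average with n factors.
-/
theorem averageCLM_adjoint_dualFunction (n : ℕ) (f : ℕ → M.families I)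
    (u : FolnerSet haar → M.families I) (hu : ∃ C, 0 ≤ C ∧ ∀ Φ i, M.Bdd C ((u Φ).1 i))
    {U : Ultrafilter (FolnerSet haar)} (hU : (U : Filter (FolnerSet haar)) ≤ folnerFilter haar)
    (Ψ : FolnerSet haar) :
    averageCLM 𝔪 Ψ n f ((inclusion 𝔪 U).adjoint
      (cls (extendMean 𝔪 U) (dualFunction n f (families.glue u hu)))) =
    (inclusion 𝔪 U).adjoint (cls (extendMean 𝔪 U) (multiAverage Ψ n fun k =>
      families.pull Extend.base (f k) * dualTwist n k (dualFactor f (families.glue u hu) k))) := by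
  refine ext_inner_right ℝ fun y => ?_
  have hd : DenseRange (cls (M := M) 𝔪) := denseRange_cls 𝔪
  refine hd.induction_on y (isClosed_eq (by fun_prop) (by fun_prop)) fun x => ?_
  rw [inner_averageCLM, ContinuousLinearMap.adjoint_inner_left,
    ContinuousLinearMap.adjoint_inner_left, inner_averageCLM_dualFunction 𝔪 n f u hu hU]

/-- A vector that is orthogonal to all vectors whose averages converge has averages that tend
to zero, provided that all shorter averages converge. -/
theorem tendsto_averageCLM_zero {n : ℕ} (hn : n ≠ 0) (f : ℕ → M.families I)
    (hconv : ∀ (U : Ultrafilter (FolnerSet haar)) (f' : ℕ → M.families (Extend haar I)),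
      ∃ L, Tendsto (fun Φ => cls (extendMean 𝔪 U) (multiAverage Φ n f')) (folnerFilter haar) (𝓝 L))
    {w : M.L2 𝔪} (hw : ∀ σ, (∃ L, Tendsto (fun Φ => averageCLM 𝔪 Φ n f σ) (folnerFilter haar)
      (𝓝 L)) → inner ℝ w σ = 0) :
    Tendsto (fun Φ => averageCLM 𝔪 Φ n f w) (folnerFilter haar) (𝓝 0) := by
  obtain ⟨C, hC0, hC⟩ := families.exists_bdd (productKernel n f)
  by_contra hcon
  rw [Metric.tendsto_nhds] at hcon
  push Not at hcon
  obtain ⟨ε, hε, hfreq⟩ := hcon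
  have hne : (folnerFilter haar ⊓ 𝓟 {Φ | ε ≤ ‖averageCLM 𝔪 Φ n f w‖}).NeBot := by
    rw [← frequently_mem_iff_neBot]
    simpa using hfreq
  -- The ultrafilter refines the Følner filter and sees only sets Φ on which the average of w is at
  -- least ε.
  let U := Ultrafilter.of (folnerFilter haar ⊓ 𝓟 {Φ | ε ≤ ‖averageCLM 𝔪 Φ n f w‖})
  have hUle := Ultrafilter.of_le (folnerFilter haar ⊓ 𝓟 {Φ | ε ≤ ‖averageCLM 𝔪 Φ n f w‖})
  have hU : (U : Filter (FolnerSet haar)) ≤ folnerFilter haar := hUle.trans inf_le_left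
  have hUε : ∀ᶠ Φ in (U : Filter (FolnerSet haar)), ε ≤ ‖averageCLM 𝔪 Φ n f w‖ :=
    hUle.trans inf_le_right (mem_principal_self _)
  have hd : DenseRange (cls (M := M) 𝔪) := denseRange_cls 𝔪
  -- Only bounded families have dual functions, so w is replaced by a nearby g. The first condition
  -- keeps ‖A_Φ g‖ above ε / 2, the second makes the error below smaller than (ε / 2)²; both hold
  -- near w since they hold at w.
  obtain ⟨g, hg1, hg2⟩ : ∃ g : M.families I, C * ‖w - cls 𝔪 g‖ < ε / 2 ∧
      ‖w - cls 𝔪 g‖ * (C * C * ‖cls 𝔪 g‖) < (ε / 2) ^ 2 := by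
    obtain ⟨g, hg⟩ := hd.exists_mem_open (s := {v | C * ‖w - v‖ < ε / 2} ∩
        {v | ‖w - v‖ * (C * C * ‖v‖) < (ε / 2) ^ 2})
      ((isOpen_lt (by fun_prop) (by fun_prop)).inter (isOpen_lt (by fun_prop) (by fun_prop)))
      ⟨w, by simp [hε], by simp; positivity⟩
    exact ⟨g, hg⟩
  obtain ⟨D, hD0, hD⟩ := families.exists_bdd g
  have hu : ∃ B, 0 ≤ B ∧ ∀ (Φ : FolnerSet haar) i, M.Bdd B ((averageOp Φ n f g).1 i) :=
    ⟨C * D, by positivity, fun Φ => bdd_averageOp Φ hC hD⟩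
  set s := cls (extendMean 𝔪 U) (dualFunction n f (families.glue (averageOp · n f g) hu)) with hs
  -- The averages of the conditional expectation of s converge by the assumption on n factors, so w
  -- is orthogonal to it.
  have hortho : inner ℝ (inclusion 𝔪 U w) s = 0 := by
    rw [← ContinuousLinearMap.adjoint_inner_right]
    refine hw _ ?_
    simp only [hs, averageCLM_adjoint_dualFunction 𝔪 n f _ hu hU]
    obtain ⟨L, hL⟩ := hconv U fun k => families.pull Extend.base (f k) *
      dualTwist n k (dualFactor f (families.glue (averageOp · n f g) hu) k)
    exact ⟨_, ((inclusion 𝔪 U).adjoint.continuous.tendsto L).comp hL⟩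
  have hlim := tendsto_inner_dualFunction 𝔪 hn f (averageOp · n f g) hu U g
  -- Here u_Φ is A_Φ g itself, so the inner product before the limit is ‖A_Φ g‖².
  have hlow : (ε / 2) ^ 2 ≤ inner ℝ (inclusion 𝔪 U (cls 𝔪 g)) s := by
    refine ge_of_tendsto hlim ?_
    filter_upwards [hUε] with Φ hΦ
    rw [averageCLM_cls, real_inner_self_eq_norm_sq, ← averageCLM_cls]
    refine pow_le_pow_left₀ (by positivity) ?_ 2
    have h1 := norm_averageCLM_le 𝔪 Φ hC0 hC (w - cls 𝔪 g)
    rw [map_sub] at h1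
    have h2 := norm_sub_norm_le (averageCLM 𝔪 Φ n f w) (averageCLM 𝔪 Φ n f (cls 𝔪 g))
    linarith
  -- One C comes from the factors in the dual function, the other from the bound of A_Φ g by g.
  have hup : inner ℝ (inclusion 𝔪 U (cls 𝔪 g)) s ≤ ‖w - cls 𝔪 g‖ * (C * C * ‖cls 𝔪 g‖) := by
    have h1 : inner ℝ (inclusion 𝔪 U (cls 𝔪 g)) s =
        inner ℝ (inclusion 𝔪 U (cls 𝔪 g - w)) s := by
      rw [map_sub, inner_sub_left, hortho, sub_zero]
    rw [h1, ← norm_neg (w - cls 𝔪 g), neg_sub]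
    exact (real_inner_le_norm _ _).trans (mul_le_mul (norm_inclusion_le 𝔪 U _)
      (norm_dualFunction_le 𝔪 hn f _ hu U hC0 hC hC0 fun Φ i => norm_averageOp_le Φ hC g i)
      (norm_nonneg _) (norm_nonneg _))
  linarith

theorem exists_tendsto_multiAverage_succ {n : ℕ} (hn : n ≠ 0) (f : ℕ → M.families I)
    (hconv : ∀ (U : Ultrafilter (FolnerSet haar)) (f' : ℕ → M.families (Extend haar I)),
      ∃ L, Tendsto (fun Φ => cls (extendMean 𝔪 U) (multiAverage Φ n f')) (folnerFilter haar)
        (𝓝 L)) :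
    ∃ L, Tendsto (fun Φ => cls 𝔪 (multiAverage Φ (n + 1) f)) (folnerFilter haar) (𝓝 L) := by
  -- Without asymptotically invariant sets the filter is trivial and any limit will do.
  rcases (folnerFilter haar).eq_or_neBot with hbot | hne
  · exact ⟨0, by rw [hbot]; exact tendsto_bot⟩
  obtain ⟨C, hC0, hC⟩ := families.exists_bdd (productKernel n f)
  let G : Submodule ℝ (M.L2 𝔪) :=
    { carrier := {w | ∃ L, Tendsto (fun Φ => averageCLM 𝔪 Φ n f w) (folnerFilter haar) (𝓝 L)}
      add_mem' := by
        rintro v w ⟨L, hL⟩ ⟨L', hL'⟩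
        exact ⟨L + L', by simpa only [map_add] using hL.add hL'⟩
      zero_mem' := ⟨0, by simpa only [map_zero] using tendsto_const_nhds⟩
      smul_mem' := by
        rintro r w ⟨L, hL⟩
        exact ⟨r • L, by simpa only [map_smul] using hL.const_smul r⟩ }
  have hG : IsClosed (G : Set (M.L2 𝔪)) :=
    isClosed_setOf_tendsto _ hC0 fun Φ => norm_averageCLM_le 𝔪 Φ hC0 hC
  have : CompleteSpace G := hG.completeSpace_coe
  -- A vector orthogonal to G has averages tending to zero, hence lies in G and is orthogonal to
  -- itself.
  have htop : G = ⊤ := by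
    rw [← Submodule.orthogonal_eq_bot_iff, Submodule.eq_bot_iff]
    intro w hw
    have h0 : w ∈ G := ⟨0, tendsto_averageCLM_zero 𝔪 hn f hconv fun σ hσ =>
      (real_inner_comm _ _).trans (hw σ hσ)⟩
    exact inner_self_eq_zero.1 (hw w h0)
  obtain ⟨L, hL⟩ : cls 𝔪 (f n) ∈ G := htop ▸ Submodule.mem_top
  refine ⟨L, hL.congr fun Φ => ?_⟩
  rw [averageCLM_cls, multiAverage_succ]

end KoopmanModel

/-- Norm convergence of multiple averages along the Følner filter, for all means. -/
theorem KoopmanModel.exists_tendsto_multiAverage.{u} {Γ : Type u} {𝓐 H : Type*} [Group Γ]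
    [TopologicalSpace Γ] [CommRing 𝓐] [Algebra ℝ 𝓐]
    [NormedAddCommGroup H] [InnerProductSpace ℝ H] (M : KoopmanModel Γ 𝓐 H)
    [CompleteSpace H] [T2Space Γ] [LocallyCompactSpace Γ] [MeasurableSpace Γ] [BorelSpace Γ]
    [IsTopologicalGroup Γ]
    (haar : Measure Γ) [IsFiniteMeasureOnCompacts haar] [haar.IsMulLeftInvariant] (n : ℕ)
    {I : Type u} [TopologicalSpace I] (𝔪 : PositiveMean I) (f : ℕ → M.families I) :
    ∃ L, Tendsto (fun Φ => cls 𝔪 (multiAverage Φ (n + 1) f)) (folnerFilter haar) (𝓝 L) := by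
  -- The index space varies in the induction; `Extend haar I` stays in the universe of Γ and I. With
  -- a single factor the average is constant.
  induction n generalizing I with
  | zero =>
    refine ⟨cls 𝔪 (f 0), tendsto_const_nhds.congr fun Φ => congrArg (cls 𝔪) ?_⟩
    refine Subtype.ext (funext fun i => M.toL2_injective ?_)
    rw [multiAverage, families.toL2_average]
    refine (Φ.setAverage_const (M.toL2 ((f 0).1 i))).symm.trans ?_
    congr 1
    ext m
    rw [productKernel_apply, Finset.prod_range_one]
    rfl
  | succ n ih =>
    exact exists_tendsto_multiAverage_succ 𝔪 n.succ_ne_zero f fun U f' => ih (extendMean 𝔪 U) f'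

/-! ### The algebra of essentially bounded functions -/

section BoundedAlgebra

variable {X : Type*} [MeasurableSpace X] {μ : Measure X}

noncomputable instance : CommRing (X →ₘ[μ] ℝ) :=
  { AEEqFun.instAddCommGroup, AEEqFun.instCommMonoid with
    left_distrib := fun a b c => AEEqFun.toGerm_injective (by
      simp only [AEEqFun.mul_toGerm, AEEqFun.add_toGerm, mul_add])
    right_distrib := fun a b c => AEEqFun.toGerm_injective (by
      simp only [AEEqFun.mul_toGerm, AEEqFun.add_toGerm, add_mul])
    zero_mul := fun a => AEEqFun.toGerm_injective (by
      simp only [AEEqFun.mul_toGerm, AEEqFun.zero_toGerm, zero_mul])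
    mul_zero := fun a => AEEqFun.toGerm_injective (by
      simp only [AEEqFun.mul_toGerm, AEEqFun.zero_toGerm, mul_zero]) }

theorem AEEqFun.smul_mul_assoc' (r : ℝ) (a b : X →ₘ[μ] ℝ) : r • a * b = r • (a * b) := by
  refine AEEqFun.ext ?_
  filter_upwards [AEEqFun.coeFn_mul (r • a) b, AEEqFun.coeFn_smul r a,
    AEEqFun.coeFn_smul r (a * b), AEEqFun.coeFn_mul a b] with x h1 h2 h3 h4
  simp only [h1, h2, h3, h4, Pi.mul_apply, Pi.smul_apply, smul_eq_mul, mul_assoc]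

noncomputable instance : Algebra ℝ (X →ₘ[μ] ℝ) :=
  Algebra.ofModule AEEqFun.smul_mul_assoc' fun r a b => by
    rw [mul_comm, AEEqFun.smul_mul_assoc', mul_comm]

theorem coeFn_algebraMap (r : ℝ) : ⇑(algebraMap ℝ (X →ₘ[μ] ℝ) r) =ᵐ[μ] fun _ => r := by
  rw [Algebra.algebraMap_eq_smul_one]
  filter_upwards [AEEqFun.coeFn_smul r (1 : X →ₘ[μ] ℝ),
    AEEqFun.coeFn_one (μ := μ) (β := ℝ)] with x h1 h2
  simp [h1, h2]

/-- The predicate that a function is bounded by `C` almost everywhere. -/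
def AEBdd (C : ℝ) (a : X →ₘ[μ] ℝ) : Prop := 0 ≤ C ∧ ∀ᵐ x ∂μ, |a x| ≤ C

theorem aebdd_algebraMap (r : ℝ) : AEBdd |r| (algebraMap ℝ (X →ₘ[μ] ℝ) r) := by
  refine ⟨abs_nonneg r, ?_⟩
  filter_upwards [coeFn_algebraMap (μ := μ) r] with x h
  rw [h]

theorem AEBdd.add {C D : ℝ} {a b : X →ₘ[μ] ℝ} (ha : AEBdd C a) (hb : AEBdd D b) :
    AEBdd (C + D) (a + b) := by
  refine ⟨add_nonneg ha.1 hb.1, ?_⟩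
  filter_upwards [ha.2, hb.2, AEEqFun.coeFn_add a b] with x h1 h2 h3
  rw [h3]
  exact (abs_add_le _ _).trans (add_le_add h1 h2)

theorem AEBdd.mul {C D : ℝ} {a b : X →ₘ[μ] ℝ} (ha : AEBdd C a) (hb : AEBdd D b) :
    AEBdd (C * D) (a * b) := by
  refine ⟨mul_nonneg ha.1 hb.1, ?_⟩
  filter_upwards [ha.2, hb.2, AEEqFun.coeFn_mul a b] with x h1 h2 h3
  rw [h3, Pi.mul_apply, abs_mul]
  exact mul_le_mul h1 h2 (abs_nonneg _) ha.1

theorem AEBdd.comp {C : ℝ} {a : X →ₘ[μ] ℝ} (ha : AEBdd C a) {T : X → X}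
    (hT : MeasurePreserving T μ μ) : AEBdd C (a.compMeasurePreserving T hT) := by
  refine ⟨ha.1, ?_⟩
  filter_upwards [a.coeFn_compMeasurePreserving hT,
    hT.quasiMeasurePreserving.tendsto_ae.eventually ha.2] with x h1 h2
  rw [h1]
  exact h2

variable (μ) in
/-- The algebra of essentially bounded real functions, up to almost everywhere equality. -/
noncomputable def boundedAlgebra : Subalgebra ℝ (X →ₘ[μ] ℝ) where
  carrier := {a | ∃ C, AEBdd C a}
  mul_mem' := by
    rintro a b ⟨C, hC⟩ ⟨D, hD⟩
    exact ⟨C * D, hC.mul hD⟩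
  add_mem' := by
    rintro a b ⟨C, hC⟩ ⟨D, hD⟩
    exact ⟨C + D, hC.add hD⟩
  algebraMap_mem' r := ⟨|r|, aebdd_algebraMap r⟩

theorem compMeasurePreserving_mul {T : X → X} (hT : MeasurePreserving T μ μ) (a b : X →ₘ[μ] ℝ) :
    (a * b).compMeasurePreserving T hT =
      a.compMeasurePreserving T hT * b.compMeasurePreserving T hT :=
  AEEqFun.induction_on₂ a b fun _ _ _ _ => rfl

theorem compMeasurePreserving_add {T : X → X} (hT : MeasurePreserving T μ μ) (a b : X →ₘ[μ] ℝ) :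
    (a + b).compMeasurePreserving T hT =
      a.compMeasurePreserving T hT + b.compMeasurePreserving T hT :=
  AEEqFun.induction_on₂ a b fun _ _ _ _ => rfl

/-- Composition with a measure preserving map, on bounded functions. -/
noncomputable def boundedAlgebra.comp (T : X → X) (hT : MeasurePreserving T μ μ) :
    boundedAlgebra μ →ₐ[ℝ] boundedAlgebra μ where
  toFun a := ⟨a.1.compMeasurePreserving T hT, a.2.imp fun _ h => h.comp hT⟩
  map_one' := rfl
  map_mul' a b := Subtype.ext (compMeasurePreserving_mul hT a.1 b.1)
  map_zero' := rfl
  map_add' a b := Subtype.ext (compMeasurePreserving_add hT a.1 b.1)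
  commutes' _ := rfl

theorem boundedAlgebra.comp_congr {S T : X → X} (hS : MeasurePreserving S μ μ)
    (hT : MeasurePreserving T μ μ) (h : S =ᵐ[μ] T) :
    boundedAlgebra.comp S hS = boundedAlgebra.comp T hT :=
  AlgHom.ext fun a => Subtype.ext (AEEqFun.compMeasurePreserving_congr a.1 hS hT.measurable h)

theorem boundedAlgebra.comp_comp {S T : X → X} (hS : MeasurePreserving S μ μ)
    (hT : MeasurePreserving T μ μ) :
    boundedAlgebra.comp (S ∘ T) (hS.comp hT) =
      boundedAlgebra.comp T hT * boundedAlgebra.comp S hS :=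
  AlgHom.ext fun a => Subtype.ext (AEEqFun.compMeasurePreserving_comp a.1 hS hT)

theorem boundedAlgebra.comp_id : boundedAlgebra.comp id (.id μ) = 1 :=
  AlgHom.ext fun a => Subtype.ext (AEEqFun.compMeasurePreserving_id a.1)

variable [IsFiniteMeasure μ]

/-- The inclusion of the bounded functions in `L²`. -/
noncomputable def boundedAlgebra.toL2 : boundedAlgebra μ →ₗ[ℝ] Lp ℝ 2 μ where
  toFun a := ⟨a.1, Lp.mem_Lp_of_ae_bound a.2.choose (a.2.choose_spec.2)⟩
  map_add' _ _ := rfl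
  map_smul' _ _ := rfl

theorem boundedAlgebra.coe_toL2 (a : boundedAlgebra μ) : ⇑(boundedAlgebra.toL2 a) = ⇑a.1 := rfl

theorem boundedAlgebra.norm_toL2_mul_le {C : ℝ} {a : boundedAlgebra μ} (h : AEBdd C a.1)
    (b : boundedAlgebra μ) :
    ‖boundedAlgebra.toL2 (a * b)‖ ≤ C * ‖boundedAlgebra.toL2 b‖ := by
  refine Lp.norm_le_mul_norm_of_ae_le_mul ?_
  filter_upwards [h.2, AEEqFun.coeFn_mul a.1 b.1] with x h1 h2
  rw [coe_toL2, coe_toL2]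
  change ‖(a.1 * b.1) x‖ ≤ _
  rw [h2, Pi.mul_apply, norm_mul]
  exact mul_le_mul_of_nonneg_right h1 (norm_nonneg _)

theorem boundedAlgebra.inner_toL2_mul (a b c : boundedAlgebra μ) :
    inner ℝ (boundedAlgebra.toL2 (a * b)) (boundedAlgebra.toL2 c) =
      inner ℝ (boundedAlgebra.toL2 b) (boundedAlgebra.toL2 (a * c)) := by
  rw [L2.inner_def, L2.inner_def]
  refine integral_congr_ae ?_
  filter_upwards [AEEqFun.coeFn_mul a.1 b.1, AEEqFun.coeFn_mul a.1 c.1] with x h1 h2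
  simp only [coe_toL2]
  change inner ℝ ((a.1 * b.1) x) (c.1 x) = inner ℝ (b.1 x) ((a.1 * c.1) x)
  rw [h1, h2]
  simp only [Pi.mul_apply, RCLike.inner_apply, conj_trivial]
  ring

/-- An L² convergent sequence has an almost everywhere convergent subsequence, along which the bound
C passes to the limit. -/
theorem boundedAlgebra.isClosed_image (C : ℝ) :
    IsClosed (boundedAlgebra.toL2 '' {a : boundedAlgebra μ | AEBdd C a.1}) := by
  rw [← isSeqClosed_iff_isClosed]
  intro u h hu hlim
  have hu' : ∀ n, 0 ≤ C ∧ ∀ᵐ x ∂μ, |u n x| ≤ C := fun n => by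
    obtain ⟨a, ha, hn⟩ := hu n
    rw [← hn]
    exact ha
  obtain ⟨φ, -, hφ⟩ := (tendstoInMeasure_of_tendsto_Lp hlim).exists_seq_tendsto_ae
  have hb : AEBdd C h.1 := by
    refine ⟨(hu' 0).1, ?_⟩
    filter_upwards [hφ, ae_all_iff.2 fun n => (hu' n).2] with x h1 h2
    exact le_of_tendsto h1.abs (Eventually.of_forall fun n => h2 (φ n))
  exact ⟨⟨h.1, C, hb⟩, hb, rfl⟩

end BoundedAlgebra

/-! ### Strong continuity and the concrete model -/

namespace MeasurePreservingAction

variable {Γ : Type*} [Group Γ] {X : Type*} [MeasurableSpace X] {μ : Measure X}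

theorem compMeasurePreserving_mul (τ : MeasurePreservingAction Γ μ) (m n : Γ) (f : Lp ℝ 2 μ) :
    Lp.compMeasurePreserving (τ.toFun (m * n)) (τ.measurePreserving _) f =
      Lp.compMeasurePreserving (τ.toFun n) (τ.measurePreserving _)
        (Lp.compMeasurePreserving (τ.toFun m) (τ.measurePreserving _) f) :=
  Subtype.ext ((AEEqFun.compMeasurePreserving_congr f.1 (τ.measurePreserving (m * n))
    ((τ.measurePreserving m).comp (τ.measurePreserving n)).measurable (τ.map_mul m n)).trans
    (AEEqFun.compMeasurePreserving_comp f.1 (τ.measurePreserving m) (τ.measurePreserving n)))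

/-- Measurable actions are strongly continuous. -/
theorem IsMeasurable.continuous [TopologicalSpace Γ] [IsTopologicalGroup Γ] [T2Space Γ]
    [LocallyCompactSpace Γ] [MeasurableSpace Γ] [BorelSpace Γ] {haar : Measure Γ}
    [haar.IsHaarMeasure] [haar.Regular] {τ : MeasurePreservingAction Γ μ}
    (hτ : τ.IsMeasurable haar) (f : Lp ℝ 2 μ) :
    Continuous fun m => Lp.compMeasurePreserving (τ.toFun m) (τ.measurePreserving m) f := by
  set F : Γ → Lp ℝ 2 μ :=
    fun m => Lp.compMeasurePreserving (τ.toFun m) (τ.measurePreserving m) f with hF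
  -- Both F m and F n are images, under the isometry of n, of F (m / n) and F 1. Continuity at 1 is
  -- therefore enough.
  have hdist : ∀ m n, dist (F m) (F n) = dist (F (m / n)) (F 1) := fun m n => by
    have h1 : F m = Lp.compMeasurePreserving (τ.toFun n) (τ.measurePreserving n) (F (m / n)) := by
      rw [hF, ← compMeasurePreserving_mul, div_mul_cancel]
    have h2 : F n = Lp.compMeasurePreserving (τ.toFun n) (τ.measurePreserving n) (F 1) := by
      rw [hF, ← compMeasurePreserving_mul, one_mul]
    rw [h1, h2]
    exact (Lp.isometry_compMeasurePreserving (τ.measurePreserving n)).dist_eq _ _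
  have hone : ∀ ε > 0, ∀ᶠ m in 𝓝 (1 : Γ), dist (F m) (F 1) < ε := by
    intro ε hε
    obtain ⟨K, hK, hK1⟩ := exists_compact_mem_nhds (1 : Γ)
    have hKpos : 0 < haar K := Measure.measure_pos_of_mem_nhds haar hK1
    obtain ⟨g, hg, hfg⟩ := hτ f K hK
    obtain ⟨S, hS, hSd⟩ := hg.isSeparable_range
    have hcover : K ⊆ ⋃ c ∈ S, (g ⁻¹' Metric.ball c (ε / 2) ∩ K) := fun m hm => by
      obtain ⟨c, hc, hcd⟩ := Metric.mem_closure_iff.1 (hSd ⟨m, rfl⟩) (ε / 2) (by positivity)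
      exact Set.mem_biUnion hc ⟨hcd, hm⟩
    -- Countably many pieces, on each of which g is close to one vector, cover a set of positive
    -- measure, so one piece is not null.
    obtain ⟨c, -, hc⟩ : ∃ c ∈ S, 0 < haar (g ⁻¹' Metric.ball c (ε / 2) ∩ K) := by
      by_contra! h
      refine hKpos.ne' (measure_mono_null hcover ?_)
      exact (measure_biUnion_null_iff hS).2 fun c hc => le_antisymm (h c hc) bot_le
    have hE0 : MeasurableSet (g ⁻¹' Metric.ball c (ε / 2) ∩ K) :=
      ((hg.dist stronglyMeasurable_const).measurable measurableSet_Iio).inter hK.measurableSet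
    have hnull : haar ({m | F m ≠ g m} ∩ K) = 0 := by
      rw [← Measure.restrict_apply' hK.measurableSet]
      exact hfg
    set N := toMeasurable haar ({m | F m ≠ g m} ∩ K)
    have hN : haar N = 0 := by rw [measure_toMeasurable, hnull]
    set E := (g ⁻¹' Metric.ball c (ε / 2) ∩ K) \ N with hE
    have hEpos : 0 < haar E := by rwa [hE, measure_sdiff_null hN]
    have hEfin : haar E ≠ ∞ :=
      ((measure_mono (Set.sdiff_subset.trans Set.inter_subset_right)).trans_lt
        hK.measure_lt_top).ne
    have hEF : ∀ m ∈ E, dist (F m) c < ε / 2 := by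
      rintro m ⟨⟨h1, h2⟩, h3⟩
      have h4 : F m = g m := by
        by_contra h
        exact h3 (subset_toMeasurable haar _ ⟨h, h2⟩)
      rw [h4]
      exact h1
    -- Steinhaus: E / E is a neighbourhood of 1, and for l = m / n with m, n ∈ E both F m and F n
    -- are within ε / 2 of c.
    filter_upwards [Measure.div_mem_nhds_one_of_haar_pos_ne_top haar E
      (hE0.diff (measurableSet_toMeasurable _ _)) hEpos hEfin] with l hl
    obtain ⟨m, hm, n, hn, rfl⟩ := Set.mem_div.1 hl
    rw [← hdist]
    have h1 := dist_triangle_right (F m) (F n) c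
    linarith [hEF m hm, hEF n hn]
  rw [continuous_iff_continuousAt]
  intro m₀
  rw [ContinuousAt, Metric.tendsto_nhds]
  intro ε hε
  have h1 : Tendsto (fun m => m / m₀) (𝓝 m₀) (𝓝 1) := by
    have : Continuous fun m : Γ => m / m₀ := by fun_prop
    simpa using this.tendsto m₀
  filter_upwards [h1.eventually (hone ε hε)] with m hm
  rwa [hdist]

/-- The trivial action. -/
def trivial (Γ : Type*) [Group Γ] (μ : Measure X) : MeasurePreservingAction Γ μ where
  toFun _ := id
  measurePreserving _ := .id μ
  map_one := .rfl
  map_mul _ _ := .rfl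

/-- The extension of a finite sequence of actions by trivial actions. -/
def extendTrivial {j : ℕ} (τ : Fin j → MeasurePreservingAction Γ μ) (i : ℕ) :
    MeasurePreservingAction Γ μ :=
  if h : i < j then τ ⟨i, h⟩ else trivial Γ μ

theorem commutes_extendTrivial {j : ℕ} {τ : Fin j → MeasurePreservingAction Γ μ}
    (hτ : ∀ i k, i ≠ k → (τ i).Commutes (τ k)) {i k : ℕ} (h : i ≠ k) :
    (extendTrivial τ i).Commutes (extendTrivial τ k) := by
  intro m n
  unfold extendTrivial
  split_ifs with hi hk
  · exact hτ _ _ (by simpa using h) m n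
  · exact .rfl
  · exact .rfl
  · exact .rfl

theorem isMeasurable_extendTrivial [TopologicalSpace Γ] [MeasurableSpace Γ] {haar : Measure Γ}
    {j : ℕ} {τ : Fin j → MeasurePreservingAction Γ μ} (hτ : ∀ i, (τ i).IsMeasurable haar) (i : ℕ) :
    (extendTrivial τ i).IsMeasurable haar := by
  unfold extendTrivial
  split_ifs with hi
  · exact hτ _
  · exact fun f K _ => (aestronglyMeasurable_const (b := f)).congr
      (Eventually.of_forall fun m => (Lp.compMeasurePreserving_id_apply f).symm)

/-- The model of commuting actions given by commuting strongly continuous measure preserving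
actions. -/
noncomputable def koopmanModel [TopologicalSpace Γ] [IsFiniteMeasure μ]
    (τ : ℕ → MeasurePreservingAction Γ μ) (hcomm : ∀ i k, i ≠ k → (τ i).Commutes (τ k))
    (hcont : ∀ i (f : Lp ℝ 2 μ), Continuous fun m =>
      Lp.compMeasurePreserving ((τ i).toFun m) ((τ i).measurePreserving m) f) :
    KoopmanModel Γ (boundedAlgebra μ) (Lp ℝ 2 μ) where
  toL2 := boundedAlgebra.toL2
  toL2_injective a b h := Subtype.ext (congrArg Subtype.val h :)
  Bdd C a := AEBdd C a.1
  bdd_nonneg h := h.1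
  bdd_algebraMap r := aebdd_algebraMap r
  bdd_add := AEBdd.add
  bdd_mul := AEBdd.mul
  norm_mul_le := boundedAlgebra.norm_toL2_mul_le
  inner_mul := boundedAlgebra.inner_toL2_mul
  isClosed_bdd := boundedAlgebra.isClosed_image
  act i m := boundedAlgebra.comp ((τ i).toFun m) ((τ i).measurePreserving m)
  bdd_act i m _ _ h := h.comp ((τ i).measurePreserving m)
  norm_act i m a := Lp.norm_compMeasurePreserving (boundedAlgebra.toL2 a)
    ((τ i).measurePreserving m)
  act_one i := (boundedAlgebra.comp_congr _ (.id μ) (τ i).map_one).trans boundedAlgebra.comp_id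
  act_mul i m n := (boundedAlgebra.comp_congr _ (((τ i).measurePreserving m).comp
    ((τ i).measurePreserving n)) ((τ i).map_mul m n)).trans (boundedAlgebra.comp_comp _ _)
  commute_act i k h m n := by
    rw [Commute, SemiconjBy, ← boundedAlgebra.comp_comp, ← boundedAlgebra.comp_comp]
    exact boundedAlgebra.comp_congr _ _ (hcomm k i h.symm n m)
  continuous_act i a := hcont i (boundedAlgebra.toL2 a)

end MeasurePreservingAction

/-! ### Specialisation to a one-point index space -/

/-- The mean of functions on a one-point space. -/
noncomputable def PositiveMean.punit.{u} : PositiveMean PUnit.{u + 1} where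
  toLinearMap :=
    { toFun := fun q => q ⟨⟩
      map_add' := fun _ _ => rfl
      map_smul' := fun _ _ => rfl }
  nonneg _ h := h ⟨⟩

namespace KoopmanModel

theorem norm_cls_punit {Γ 𝓐 H : Type*} [Group Γ] [TopologicalSpace Γ] [CommRing 𝓐] [Algebra ℝ 𝓐]
    [NormedAddCommGroup H] [InnerProductSpace ℝ H] {M : KoopmanModel Γ 𝓐 H}
    (F : M.families PUnit) : ‖cls PositiveMean.punit F‖ = ‖M.toL2 (F.1 ⟨⟩)‖ := by
  rw [← sq_eq_sq₀ (norm_nonneg _) (norm_nonneg _), norm_cls_sq, ← real_inner_self_eq_norm_sq]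
  rfl

theorem continuous_prod_partialAct {Γ 𝓐 H : Type*} [Group Γ] [TopologicalSpace Γ] [CommRing 𝓐]
    [Algebra ℝ 𝓐] [NormedAddCommGroup H] [InnerProductSpace ℝ H] (M : KoopmanModel Γ 𝓐 H)
    (hM : ∀ a, ∃ C, M.Bdd C a) (n : ℕ) (a : ℕ → 𝓐) :
    Continuous fun m => M.toL2 (∏ k ∈ Finset.range n, M.partialAct k m (a k)) := by
  have h := (families.continuous (productKernel n fun k => (⟨fun _ => a k,
    (hM (a k)).imp fun _ h => ⟨M.bdd_nonneg h, fun _ => h⟩, continuous_const⟩ :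
    M.families PUnit.{1}))).comp (by fun_prop : Continuous fun m : Γ => (m, PUnit.unit))
  simpa only [Function.comp_def, productKernel_apply] using h

/-- Convergence of multiple ergodic averages of elements of the algebra. -/
theorem exists_tendsto_average.{u} {Γ : Type u} {𝓐 H : Type*} [Group Γ] [TopologicalSpace Γ]
    [CommRing 𝓐] [Algebra ℝ 𝓐] [NormedAddCommGroup H] [InnerProductSpace ℝ H] [CompleteSpace H]
    [IsTopologicalGroup Γ] [T2Space Γ] [LocallyCompactSpace Γ] [MeasurableSpace Γ] [BorelSpace Γ]
    (haar : Measure Γ) [IsFiniteMeasureOnCompacts haar] [haar.IsMulLeftInvariant]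
    (M : KoopmanModel Γ 𝓐 H) (hM : ∀ a, ∃ C, M.Bdd C a) (n : ℕ) (a : ℕ → 𝓐) :
    ∃ L, Tendsto (fun Φ : FolnerSet haar =>
      ⨍ m in Φ.1, M.toL2 (∏ k ∈ Finset.range (n + 1), M.partialAct k m (a k)) ∂haar)
        (folnerFilter haar) (𝓝 L) := by
  rcases (folnerFilter haar).eq_or_neBot with h | h
  · exact ⟨0, by rw [h]; exact tendsto_bot⟩
  set g : ℕ → M.families PUnit.{u + 1} := fun k => ⟨fun _ => a k,
    (hM (a k)).imp fun _ h => ⟨M.bdd_nonneg h, fun _ => h⟩, continuous_const⟩ with hg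
  have hval : ∀ Φ : FolnerSet haar, M.toL2 ((multiAverage Φ (n + 1) g).1 ⟨⟩) =
      ⨍ m in Φ.1, M.toL2 (∏ k ∈ Finset.range (n + 1), M.partialAct k m (a k)) ∂haar := fun Φ => by
    rw [multiAverage, families.toL2_average]
    simp only [productKernel_apply, hg]
  simp_rw [← hval]
  -- The known limit lies in the abstract completion, not in H. Since classes of families have the
  -- same norm as their values, the Cauchy property carries over to the complete space H.
  have h1 := cauchy_map_iff_exists_tendsto.2
    (M.exists_tendsto_multiAverage haar n PositiveMean.punit g)
  refine cauchy_map_iff_exists_tendsto.1 ?_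
  rw [cauchy_map_iff, Metric.uniformity_eq_comap_nhds_zero, tendsto_comap_iff] at h1 ⊢
  refine ⟨h, h1.2.congr fun p => ?_⟩
  simp only [Function.comp_apply, dist_eq_norm, ← map_sub]
  exact norm_cls_punit _

end KoopmanModel

theorem IsFolnerNet.tendsto_of_folnerFilter {Γ : Type*} [Group Γ] [TopologicalSpace Γ]
    [MeasurableSpace Γ] {haar : Measure Γ} {A : Type*} [Preorder A] {Φ : A → Set Γ}
    (hΦ : IsFolnerNet haar Φ) {E : Type*} {l : Filter E} {g : Set Γ → E}
    (h : Tendsto (fun Φ : FolnerSet haar => g Φ.1) (folnerFilter haar) l) :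
    Tendsto (fun α => g (Φ α)) atTop l :=
  h.comp hΦ.tendsto_folnerFilter

/-! ### Real and imaginary parts -/

section Components

variable {X : Type*} [MeasurableSpace X] {μ : Measure X} {𝕜 : Type*} [RCLike 𝕜]

theorem ae_norm_le_norm (f : Lp 𝕜 ∞ μ) : ∀ᵐ x ∂μ, ‖f x‖ ≤ ‖f‖ := by
  filter_upwards [ae_le_eLpNormEssSup (f := f) (μ := μ)] with x hx
  rw [← eLpNorm_exponent_top] at hx
  have := ENNReal.toReal_mono (Lp.eLpNorm_ne_top f) hx
  simpa [Lp.norm_def] using this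

/-- The composition of a bounded function with a contraction to the reals. -/
noncomputable def boundedAlgebra.ofLp (r : 𝕜 → ℝ) (hr : Continuous r) (h : ∀ z, |r z| ≤ ‖z‖)
    (f : Lp 𝕜 ∞ μ) : boundedAlgebra μ :=
  ⟨AEEqFun.comp r hr f.1, ‖f‖, norm_nonneg _, by
    filter_upwards [AEEqFun.coeFn_comp r hr f.1, ae_norm_le_norm f] with x h1 h2
    rw [h1]
    exact (h _).trans h2⟩

/-- The real part of `f` if `p` holds, and the imaginary part otherwise. -/
noncomputable def boundedAlgebra.part (p : Prop) [Decidable p] (f : Lp 𝕜 ∞ μ) : boundedAlgebra μ :=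
  if p then ofLp RCLike.re RCLike.continuous_re RCLike.abs_re_le_norm f
  else ofLp RCLike.im RCLike.continuous_im RCLike.abs_im_le_norm f

theorem boundedAlgebra.coeFn_part (p : Prop) [Decidable p] (f : Lp 𝕜 ∞ μ) :
    ⇑(part p f).1 =ᵐ[μ] fun x => if p then RCLike.re (f x) else RCLike.im (f x) := by
  unfold part
  split_ifs
  · exact AEEqFun.coeFn_comp _ RCLike.continuous_re _
  · exact AEEqFun.coeFn_comp _ RCLike.continuous_im _

theorem boundedAlgebra.coeFn_prod {ι : Type*} (s : Finset ι) (a : ι → boundedAlgebra μ) :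
    ⇑(∏ k ∈ s, a k).1 =ᵐ[μ] fun x => ∏ k ∈ s, (a k).1 x := by
  classical
  induction s using Finset.induction_on with
  | empty =>
    simp only [Finset.prod_empty]
    exact AEEqFun.coeFn_one
  | insert i s hi ih =>
    rw [Finset.prod_insert hi]
    filter_upwards [ih, AEEqFun.coeFn_mul (a i).1 (∏ k ∈ s, a k).1] with x h1 h2
    rw [Finset.prod_insert hi, ← h1]
    exact h2

end Components

/-- Expand the product of re + i im; s is the set of indices that contribute their real part. -/
theorem RCLike.prod_eq_sum_re_im {𝕜 ι : Type*} [RCLike 𝕜] [Fintype ι] [DecidableEq ι] (z : ι → 𝕜) :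
    ∏ k, z k = ∑ s : Finset ι, (I : 𝕜) ^ (Finset.univ \ s).card *
      ((∏ k, if k ∈ s then re (z k) else im (z k) : ℝ) : 𝕜) := by
  have h : ∏ k, z k = ∏ k, ((re (z k) : 𝕜) + (im (z k) : 𝕜) * I) :=
    Finset.prod_congr rfl fun k _ => (re_add_im (z k)).symm
  rw [h, Finset.prod_add, Finset.powerset_univ]
  refine Finset.sum_congr rfl fun s _ => ?_
  rw [Finset.prod_mul_distrib, Finset.prod_const, Finset.prod_ite, RCLike.ofReal_mul,
    RCLike.ofReal_prod, RCLike.ofReal_prod, Finset.filter_mem_eq_inter, Finset.univ_inter,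
    Finset.filter_notMem_eq_sdiff]
  ring

/-! ### From the real model to multicorrelations -/

namespace MeasurePreservingAction

variable {Γ : Type*} [Group Γ] {X : Type*} [MeasurableSpace X] {μ : Measure X} {j : ℕ}

/-- The model of commuting actions given by finitely many commuting measurable actions. -/
noncomputable def finKoopmanModel [TopologicalSpace Γ] [IsTopologicalGroup Γ] [T2Space Γ]
    [LocallyCompactSpace Γ] [MeasurableSpace Γ] [BorelSpace Γ] {haar : Measure Γ}
    [haar.IsHaarMeasure] [haar.Regular] [IsFiniteMeasure μ]
    {τ : Fin j → MeasurePreservingAction Γ μ} (hmeas : ∀ i, (τ i).IsMeasurable haar)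
    (hcomm : ∀ i k, i ≠ k → (τ i).Commutes (τ k)) :
    KoopmanModel Γ (boundedAlgebra μ) (Lp ℝ 2 μ) :=
  koopmanModel (extendTrivial τ) (fun _ _ h => commutes_extendTrivial hcomm h)
    fun i => (isMeasurable_extendTrivial hmeas i).continuous

section

variable [TopologicalSpace Γ] [IsTopologicalGroup Γ] [T2Space Γ] [LocallyCompactSpace Γ]
  [MeasurableSpace Γ] [BorelSpace Γ] {haar : Measure Γ} [haar.IsHaarMeasure] [haar.Regular]
  [IsFiniteMeasure μ] {τ : Fin j → MeasurePreservingAction Γ μ}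
  (hmeas : ∀ i, (τ i).IsMeasurable haar) (hcomm : ∀ i k, i ≠ k → (τ i).Commutes (τ k))

/-- Composition operators reverse the order, so composing with one more transformation on the inside
multiplies by its operator on the left, as in `partialAct`. -/
theorem partialAct_finKoopmanModel (m : Γ) (k : Fin (j + 1)) :
    (finKoopmanModel hmeas hcomm).partialAct k m =
      boundedAlgebra.comp (partialComp τ m k) (measurePreserving_partialComp τ m k) := by
  induction k using Fin.induction with
  | zero => exact boundedAlgebra.comp_id.symm
  | succ i ih =>
    have h : extendTrivial τ i = τ i := dif_pos i.2
    have h1 : (finKoopmanModel hmeas hcomm).act i m =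
        boundedAlgebra.comp ((τ i).toFun m) ((τ i).measurePreserving m) := by
      change boundedAlgebra.comp ((extendTrivial τ i).toFun m)
        ((extendTrivial τ i).measurePreserving m) = _
      congr 1
      rw [h]
    rw [Fin.val_succ, KoopmanModel.partialAct, h1]
    exact (congrArg _ ih).trans (boundedAlgebra.comp_comp
      (measurePreserving_partialComp τ m i.castSucc) ((τ i).measurePreserving m)).symm

/-- The real multicorrelation sequence of the real or imaginary parts of `f`. -/
noncomputable def partCorrelation {𝕜 : Type*} [RCLike 𝕜] (f : Fin (j + 1) → Lp 𝕜 ∞ μ)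
    (s : Finset (Fin (j + 1))) (m : Γ) : Lp ℝ 2 μ :=
  boundedAlgebra.toL2 (∏ k ∈ Finset.range (j + 1), (finKoopmanModel hmeas hcomm).partialAct k m
    (if h : k < j + 1 then boundedAlgebra.part (⟨k, h⟩ ∈ s) (f ⟨k, h⟩) else 1))

theorem coeFn_partCorrelation {𝕜 : Type*} [RCLike 𝕜] (f : Fin (j + 1) → Lp 𝕜 ∞ μ)
    (s : Finset (Fin (j + 1))) (m : Γ) :
    ⇑(partCorrelation hmeas hcomm f s m) =ᵐ[μ] fun x => ∏ k, if k ∈ s then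
      RCLike.re (f k (partialComp τ m k x)) else RCLike.im (f k (partialComp τ m k x)) := by
  have h1 : ∀ k : Fin (j + 1), ⇑((finKoopmanModel hmeas hcomm).partialAct k m
      (boundedAlgebra.part (k ∈ s) (f k))).1 =ᵐ[μ] fun x => if k ∈ s then
      RCLike.re (f k (partialComp τ m k x)) else RCLike.im (f k (partialComp τ m k x)) := fun k => by
    rw [partialAct_finKoopmanModel]
    have hT := measurePreserving_partialComp τ m k
    exact (AEEqFun.coeFn_compMeasurePreserving _ hT).trans
      (hT.quasiMeasurePreserving.ae_eq_comp (boundedAlgebra.coeFn_part (k ∈ s) (f k)))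
  rw [partCorrelation, boundedAlgebra.coe_toL2, Finset.prod_range]
  refine (boundedAlgebra.coeFn_prod _ _).trans ?_
  filter_upwards [ae_all_iff.2 h1] with x hx
  refine Finset.prod_congr rfl fun k _ => ?_
  rw [← hx k]
  simp only [Fin.is_lt, dite_true, Fin.eta]

theorem continuous_partCorrelation {𝕜 : Type*} [RCLike 𝕜] (f : Fin (j + 1) → Lp 𝕜 ∞ μ)
    (s : Finset (Fin (j + 1))) : Continuous (partCorrelation hmeas hcomm f s) :=
  (finKoopmanModel hmeas hcomm).continuous_prod_partialAct (fun a => a.2) _ _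

/-- This reduces both integrability and convergence to the real case, since the sum is finite and
each summand is a fixed continuous linear map of a real correlation. -/
theorem multicorrelation_eq_sum {𝕜 : Type*} [RCLike 𝕜] (f : Fin (j + 1) → Lp 𝕜 ∞ μ) (m : Γ) :
    multicorrelation τ f m = ∑ s : Finset (Fin (j + 1)), (RCLike.I : 𝕜) ^ (Finset.univ \ s).card •
      (RCLike.ofRealCLM (K := 𝕜)).compLpL 2 μ (partCorrelation hmeas hcomm f s m) := by
  refine Lp.ext ?_
  refine (MemLp.coeFn_toLp _).trans ?_
  refine EventuallyEq.trans ?_ (Lp.coeFn_finsetSum _ _).symm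
  have h1 : ∀ s : Finset (Fin (j + 1)), ⇑((RCLike.I : 𝕜) ^ (Finset.univ \ s).card •
      (RCLike.ofRealCLM (K := 𝕜)).compLpL 2 μ (partCorrelation hmeas hcomm f s m)) =ᵐ[μ]
      fun x => (RCLike.I : 𝕜) ^ (Finset.univ \ s).card * ((∏ k, if k ∈ s then
        RCLike.re (f k (partialComp τ m k x)) else RCLike.im (f k (partialComp τ m k x)) : ℝ) : 𝕜) :=
    fun s => by
      filter_upwards [Lp.coeFn_smul ((RCLike.I : 𝕜) ^ (Finset.univ \ s).card)
        ((RCLike.ofRealCLM (K := 𝕜)).compLpL 2 μ (partCorrelation hmeas hcomm f s m)),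
        (RCLike.ofRealCLM (K := 𝕜)).coeFn_compLpL (partCorrelation hmeas hcomm f s m),
        coeFn_partCorrelation hmeas hcomm f s m] with x h1 h2 h3
      rw [h1, Pi.smul_apply, h2, h3]
      rfl
  filter_upwards [ae_all_iff.2 h1] with x hx
  rw [RCLike.prod_eq_sum_re_im, Finset.sum_apply]
  exact Finset.sum_congr rfl fun s _ => (hx s).symm

theorem continuous_multicorrelation
    (hmeas : ∀ i, (τ i).IsMeasurable haar) (hcomm : ∀ i k, i ≠ k → (τ i).Commutes (τ k))
    {𝕜 : Type*} [RCLike 𝕜] (f : Fin (j + 1) → Lp 𝕜 ∞ μ) :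
    Continuous (multicorrelation τ f) := by
  rw [funext (multicorrelation_eq_sum hmeas hcomm f)]
  refine continuous_finsetSum _ fun s _ => ?_
  exact (ContinuousLinearMap.continuous ((RCLike.I : 𝕜) ^ (Finset.univ \ s).card •
    (RCLike.ofRealCLM (K := 𝕜)).compLpL 2 μ)).comp (continuous_partCorrelation hmeas hcomm f s)

theorem exists_tendsto_average_multicorrelation
    (hmeas : ∀ i, (τ i).IsMeasurable haar) (hcomm : ∀ i k, i ≠ k → (τ i).Commutes (τ k))
    {𝕜 : Type*} [RCLike 𝕜]
    (f : Fin (j + 1) → Lp 𝕜 ∞ μ) :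
    ∃ L, Tendsto (fun Φ : FolnerSet haar => ⨍ m in Φ.1, multicorrelation τ f m ∂haar)
      (folnerFilter haar) (𝓝 L) := by
  have h : ∀ s, ∃ L, Tendsto (fun Φ : FolnerSet haar =>
      ⨍ m in Φ.1, partCorrelation hmeas hcomm f s m ∂haar) (folnerFilter haar) (𝓝 L) := fun s =>
    (finKoopmanModel hmeas hcomm).exists_tendsto_average haar (fun a => a.2) j _
  choose L hL using h
  set T : Finset (Fin (j + 1)) → Lp ℝ 2 μ →L[ℝ] Lp 𝕜 2 μ := fun s =>
    (RCLike.I : 𝕜) ^ (Finset.univ \ s).card • (RCLike.ofRealCLM (K := 𝕜)).compLpL 2 μ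
  have e : ∀ Φ : FolnerSet haar, ⨍ m in Φ.1, multicorrelation τ f m ∂haar =
      ∑ s, T s (⨍ m in Φ.1, partCorrelation hmeas hcomm f s m ∂haar) := fun Φ => by
    have hc := fun s => Φ.integrableOn (continuous_partCorrelation hmeas hcomm f s)
    have h1 : ∀ m, multicorrelation τ f m = ∑ s, T s (partCorrelation hmeas hcomm f s m) :=
      multicorrelation_eq_sum hmeas hcomm f
    simp only [setAverage_eq, map_smul, ← Finset.smul_sum]
    rw [integral_congr_ae (Eventually.of_forall h1),
      integral_finsetSum _ fun s _ => (T s).integrable_comp (hc s)]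
    exact congrArg _ (Finset.sum_congr rfl fun s _ => (T s).integral_comp_comm (hc s))
  exact ⟨∑ s, T s (L s), (tendsto_finsetSum _ fun s _ =>
    ((T s).continuous.tendsto _).comp (hL s)).congr fun Φ => (e Φ).symm⟩

end

end MeasurePreservingAction

theorem mainTheorem12
    {Γ : Type*} [Group Γ] [TopologicalSpace Γ] [IsTopologicalGroup Γ] [T2Space Γ]
    [LocallyCompactSpace Γ] [MeasurableSpace Γ] [BorelSpace Γ]
    (haar : Measure Γ) [haar.IsHaarMeasure] [haar.Regular]
    {X : Type*} [MeasurableSpace X] (μ : Measure X) [IsProbabilityMeasure μ]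
    {𝕜 : Type*} [RCLike 𝕜]
    (j : ℕ) (τ : Fin j → MeasurePreservingAction Γ μ)
    (hmeas : ∀ i, (τ i).IsMeasurable haar)
    (hcomm : ∀ i k, i ≠ k → (τ i).Commutes (τ k))
    (f : Fin (j + 1) → Lp 𝕜 ∞ μ) :
    (∀ K : Set Γ, IsCompact K →
      IntegrableOn (MeasurePreservingAction.multicorrelation τ f) K haar) ∧
    ∃ L : Lp 𝕜 2 μ, ∀ {A : Type*} [Preorder A] [IsDirectedOrder A] [Nonempty A] (Φ : A → Set Γ),
      IsFolnerNet haar Φ →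
        Tendsto (fun α => ⨍ m in Φ α, MeasurePreservingAction.multicorrelation τ f m ∂haar)
          atTop (𝓝 L) := by
  refine ⟨?_, ?_⟩
  · intro K hK
    exact (MeasurePreservingAction.continuous_multicorrelation hmeas hcomm
      f).continuousOn.integrableOn_compact hK
  -- The limit along the Følner filter is fixed before any net is chosen, which is the independence
  -- claim.
  · obtain ⟨L, hL⟩ :=
      MeasurePreservingAction.exists_tendsto_average_multicorrelation hmeas hcomm f
    refine ⟨L, ?_⟩
    intro A _ _ _ Φ hΦ
    exact hΦ.tendsto_of_folnerFilter
      (g := fun Φ => ⨍ m in Φ, MeasurePreservingAction.multicorrelation τ f m ∂haar) hL
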